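/- Let $M$ be a compact smooth Riemannian manifold without boundary, let $\operatorname{Leb}$ be its normalized Riemannian volume, and let $C^2(M,M)$ carry the $C^1$ topology or the $C^2$ topology (the same one throughout). For a map $g\colon M\to M$: * an SRB measure of $g$ is an ergodic $g$-invariant Borel probability measure $\mu$ on $M$ such that the set of points $x\in M$ satisfying $$\lim_{n\to\infty}\frac1n\sum_{j=0}^{n-1}\varphi(g^j(x))=\int\varphi\,d\mu\qquad\text{for all continuous }\varphi\colon M\to\mathbb R$$ has positive $\operatorname{Leb}$ measure; * a $g$-invariant probability measure $\mu$ is expanding if for $\mu$-almost every $x\in M$ and every $v\in T_xM\setminus\{0\}$ the Lyapunov exponent $\lambda(x,v)=\lim_{n\to\infty}\frac1n\log\|Dg^n(x)v\|$ exists and is positive. Let $\mathcal F\subset C^2(M,M)$ be a family of local diffeomorphisms. A map $f\in\mathcal F$ is statistically stable (within $\mathcal F$) if $f$ has finitely many SRB measures $\nu_1,\dots,\nu_p$ such that, for every family $(g_\epsilon)_{\epsilon>0}$ in $\mathcal F$ with $g_\epsilon\to f$ as $\epsilon\to0$ and every choice of SRB measures $\mu_\epsilon$ of $g_\epsilon$,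 all weak$^*$ accumulation points of $(\mu_\epsilon)_{\epsilon>0}$ as $\epsilon\to0$ lie in the convex hull of $\nu_1,\dots,\nu_p$. If every $f\in\mathcal F$ is statistically stable, then the set of those $f\in\mathcal F$ all of whose SRB measures are expanding is open in $\mathcal F$. -/

import Mathlib

open Set Filter Topology MeasureTheory Bundle Manifold
open scoped ENNReal NNReal ContDiff

noncomputable section

section Topologies

variable {E : Type*} [NormedAddCommGroup E] [NormedSpace ℝ E]
  {M : Type*} [TopologicalSpace M] [ChartedSpace E M] [IsManifold 𝓘(ℝ, E) ∞ M]

/-- The tangent map `Tf : TM → TM` of a `C^2` map `f : M → M`, as a continuous map. -/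
def tangentC (f : C^2⟮𝓘(ℝ, E), M; 𝓘(ℝ, E), M⟯) :
    C(TangentBundle 𝓘(ℝ, E) M, TangentBundle 𝓘(ℝ, E) M) :=
  ⟨tangentMap 𝓘(ℝ, E) 𝓘(ℝ, E) f, f.contMDiff.continuous_tangentMap one_le_two⟩

instance tangentBundle_isManifold_one :
    IsManifold 𝓘(ℝ, E).tangent 1 (TangentBundle 𝓘(ℝ, E) M) :=
  Bundle.TotalSpace.isManifold E (TangentSpace 𝓘(ℝ, E) : M → Type _)

/-- The second tangent map `TTf : TTM → TTM` of a `C^2` map `f : M → M`, as a continuous map. -/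
def tangentTangentC (f : C^2⟮𝓘(ℝ, E), M; 𝓘(ℝ, E), M⟯) :
    C(TangentBundle 𝓘(ℝ, E).tangent (TangentBundle 𝓘(ℝ, E) M),
      TangentBundle 𝓘(ℝ, E).tangent (TangentBundle 𝓘(ℝ, E) M)) :=
  ⟨tangentMap 𝓘(ℝ, E).tangent 𝓘(ℝ, E).tangent (tangentMap 𝓘(ℝ, E) 𝓘(ℝ, E) f),
    (f.contMDiff.contMDiff_tangentMap (m := 1) (by norm_num)).continuous_tangentMap le_rfl⟩

variable (E M) in
/-- The `C^1` topology on `C^2(M, M)`: uniform convergence of `Tf` on compact subsets of `TM`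
(in charts: uniform convergence of the maps and of their first derivatives on compact sets). -/
@[reducible] def c1Topology : TopologicalSpace C^2⟮𝓘(ℝ, E), M; 𝓘(ℝ, E), M⟯ :=
  TopologicalSpace.induced tangentC ContinuousMap.compactOpen

variable (E M) in
/-- The `C^2` topology on `C^2(M, M)`: uniform convergence of `Tf` and of `TTf` on compact sets
(in charts: uniform convergence of the maps and of their first and second derivatives). -/
@[reducible] def c2Topology : TopologicalSpace C^2⟮𝓘(ℝ, E), M; 𝓘(ℝ, E), M⟯ :=
  c1Topology E M ⊓ TopologicalSpace.induced tangentTangentC ContinuousMap.compactOpen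

end Topologies

section Dynamics

variable {E : Type*} [NormedAddCommGroup E] [NormedSpace ℝ E]
  {M : Type*} [EMetricSpace M] [ChartedSpace E M]
  [MeasurableSpace M] [BorelSpace M]

variable (E M) in
/-- The normalized Riemannian volume of a compact Riemannian manifold `M` modelled on `E`. When the
distance of `M` is the Riemannian one, the Riemannian volume is a constant multiple of the Hausdorff
measure of dimension `dim M`, and the constant disappears in the normalization. -/
def lebesgueMeasure : Measure M :=
  (μH[(Module.finrank ℝ E : ℝ)] (univ : Set M))⁻¹ • μH[(Module.finrank ℝ E : ℝ)]

/-- The basin of `μ`: the points `x` with `(1/n) ∑_{j<n} φ(f^j x) → ∫ φ dμ` for all continuous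
`φ : M → ℝ`. -/
def basin (f : M → M) (μ : ProbabilityMeasure M) : Set M :=
  {x | ∀ φ : C(M, ℝ), Tendsto (fun n : ℕ => birkhoffAverage ℝ f φ n x) atTop
    (𝓝 (∫ y, φ y ∂(μ : Measure M)))}

variable (E) in
/-- `μ` is an (ergodic, `f`-invariant) SRB measure of `f`: its basin has positive Lebesgue measure.
Note that `Ergodic` includes the invariance of the measure. -/
def IsSRB (f : M → M) (μ : ProbabilityMeasure M) : Prop :=
  Ergodic f (μ : Measure M) ∧ 0 < lebesgueMeasure E M (basin f μ)

variable (E) in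
/-- `f`, a member of the family `F`, is statistically stable (within `F`, where `C^2(M, M)` carries
the topology `τ`): there are finitely many SRB measures `ν_1, …, ν_p` of `f` such that, whenever
maps `g_ε ∈ F`, `ε > 0`, converge to `f` as `ε → 0` and `μ_ε` is an SRB measure of `g_ε`, all weak*
accumulation points of `μ_ε` as `ε → 0` lie in the convex hull of `ν_1, …, ν_p`. -/
def IsStatisticallyStable (τ : TopologicalSpace C^2⟮𝓘(ℝ, E), M; 𝓘(ℝ, E), M⟯)
    (F : Set C^2⟮𝓘(ℝ, E), M; 𝓘(ℝ, E), M⟯) (f : C^2⟮𝓘(ℝ, E), M; 𝓘(ℝ, E), M⟯) : Prop :=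
  ∃ (p : ℕ) (ν : Fin p → ProbabilityMeasure M), (∀ i, IsSRB E f (ν i)) ∧
    ∀ (g : ℝ → C^2⟮𝓘(ℝ, E), M; 𝓘(ℝ, E), M⟯) (μ : ℝ → ProbabilityMeasure M),
      (∀ ε > 0, g ε ∈ F) → Tendsto g (𝓝[>] 0) (@nhds _ τ f) →
      (∀ ε > 0, IsSRB E (g ε) (μ ε)) →
      ∀ μ₀ : ProbabilityMeasure M, MapClusterPt μ₀ (𝓝[>] 0) μ →
        ∃ w : Fin p → ℝ≥0, ∑ i, w i = 1 ∧
          (μ₀ : Measure M) = ∑ i, w i • (ν i : Measure M)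

variable [RiemannianBundle (fun x : M => TangentSpace 𝓘(ℝ, E) x)]

variable (E) in
/-- `l` is the Lyapunov exponent of `f` at `x` in the direction `v`: the limit of
`(1/n) log ‖D f^n(x) v‖` exists and equals `l`. -/
def HasLyapunovExponent (f : M → M) (x : M) (v : TangentSpace 𝓘(ℝ, E) x) (l : ℝ) : Prop :=
  Tendsto (fun n : ℕ => (1 / (n : ℝ)) *
    Real.log ‖mfderiv 𝓘(ℝ, E) 𝓘(ℝ, E) (f^[n]) x v‖) atTop (𝓝 l)

variable (E) in
/-- `μ` is expanding for `f`: at `μ`-almost every point, the Lyapunov exponents exist and are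
positive in all nonzero directions. -/
def IsExpanding (f : M → M) (μ : ProbabilityMeasure M) : Prop :=
  ∀ᵐ x ∂(μ : Measure M), ∀ v : TangentSpace 𝓘(ℝ, E) x, v ≠ 0 →
    ∃ l : ℝ, 0 < l ∧ HasLyapunovExponent E f x v l

end Dynamics

end

/-! Argue by contradiction: let `f` have only expanding SRB measures, and let non-expanding SRB
measures `μ n` of maps `g n → f` be given. An embedding of `M` into a Euclidean space turns tangent
spaces into subspaces and derivatives into linear cocycles, which act on the unit sphere bundle.

By the multiplicative ergodic theorem, exponents exist `μ n`-almost everywhere in all nonzero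
directions. So non-expansion is never mere non-existence of a limit: over some typical point there
is a vector with exponent `≤ 0`. Empirical measures along its orbit in the sphere bundle accumulate
at an invariant lift of `μ n` whose integral of the logarithmic expansion equals that exponent
(`exists_lift_integral_logNorm_nonpos`). Invariance and the sign of the integral survive weak*
limits, so some accumulation point `μ₀` of the `μ n` has an invariant lift for `f` with integral `≤
0`. If `μ₀` were expanding, Birkhoff averages would converge almost everywhere to positive limits
and the integral would be positive (`integral_logNorm_pos`). But statistical stability makes `μ₀` a
convex combination of SRB measures of `f`, hence expanding.

The one-sided multiplicative ergodic theorem comes from lifting to orthonormal frames. Gram–Schmidt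
makes the cocycle upper triangular, Birkhoff's theorem gives its diagonal entries exact exponents,
and a triangular system with bounded entries and exact positive diagonal rates has an exact exponent
on every nonzero solution (`tendsto_log_triangular_solution`). -/

/-! ### Birkhoff's ergodic theorem for bounded measurable functions -/

section Birkhoff

variable {α : Type*} {T : α → α} {φ : α → ℝ} {C : ℝ}

theorem abs_birkhoffSum_le (hb : ∀ x, |φ x| ≤ C) (n : ℕ) (x : α) :
    |birkhoffSum T φ n x| ≤ n * C := by
  unfold birkhoffSum
  calc |∑ k ∈ Finset.range n, φ (T^[k] x)| ≤ ∑ k ∈ Finset.range n, |φ (T^[k] x)| :=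
        Finset.abs_sum_le_sum_abs _ _
    _ ≤ ∑ k ∈ Finset.range n, C := Finset.sum_le_sum fun _ _ => hb _
    _ = n * C := by simp

theorem abs_birkhoffAverage_le (hb : ∀ x, |φ x| ≤ C) (n : ℕ) (x : α) :
    |birkhoffAverage ℝ T φ n x| ≤ C := by
  have hC : 0 ≤ C := (abs_nonneg _).trans (hb x)
  rcases Nat.eq_zero_or_pos n with rfl | hn
  · simpa using hC
  · have hn' : (0 : ℝ) < n := by exact_mod_cast hn
    rw [birkhoffAverage, smul_eq_mul, abs_mul, abs_inv, abs_of_pos hn', inv_mul_le_iff₀ hn']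
    exact abs_birkhoffSum_le hb n x

/-- The running maximum `max (0, S_1 φ, …, S_N φ)` of the Birkhoff sums. -/
noncomputable def maxBirkhoffSum (T : α → α) (φ : α → ℝ) (N : ℕ) (x : α) : ℝ :=
  (Finset.range (N + 1)).sup' ⟨0, by simp⟩ fun k => birkhoffSum T φ k x

theorem maxBirkhoffSum_nonneg (N : ℕ) (x : α) : 0 ≤ maxBirkhoffSum T φ N x := by
  have := Finset.le_sup' (fun k => birkhoffSum T φ k x) (show 0 ∈ Finset.range (N + 1) by simp)
  simpa [maxBirkhoffSum] using this

theorem abs_maxBirkhoffSum_le (hb : ∀ x, |φ x| ≤ C) (N : ℕ) (x : α) :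
    |maxBirkhoffSum T φ N x| ≤ N * C := by
  have hC : 0 ≤ C := (abs_nonneg _).trans (hb x)
  rw [abs_of_nonneg (maxBirkhoffSum_nonneg N x)]
  refine Finset.sup'_le _ _ fun k hk => ?_
  refine (le_abs_self _).trans ((abs_birkhoffSum_le hb k x).trans ?_)
  have : (k : ℝ) ≤ N := by exact_mod_cast Nat.lt_succ_iff.1 (Finset.mem_range.1 hk)
  gcongr

/-- A positive maximum is attained at an index `k + 1`, and `S_{k+1} φ (x) = φ x + S_k φ (T x)`. -/
theorem maxBirkhoffSum_le_add (N : ℕ) (x : α) (hx : 0 < maxBirkhoffSum T φ N x) :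
    maxBirkhoffSum T φ N x ≤ φ x + maxBirkhoffSum T φ N (T x) := by
  obtain ⟨k, hk, hkx⟩ := Finset.exists_mem_eq_sup' (s := Finset.range (N + 1)) ⟨0, by simp⟩
    (fun k => birkhoffSum T φ k x)
  change maxBirkhoffSum T φ N x = _ at hkx
  rcases k with _ | k
  · simp [hkx] at hx
  · rw [hkx, birkhoffSum_succ']
    gcongr
    refine Finset.le_sup' (fun k => birkhoffSum T φ k (T x)) ?_
    simp at hk ⊢
    omega

theorem birkhoffSum_sub_const (c : ℝ) (n : ℕ) (x : α) :
    birkhoffSum T (fun y => φ y - c) n x = birkhoffSum T φ n x - n * c := by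
  simp [birkhoffSum]

/-- The points whose Birkhoff averages cross from below `a` to above `b`, with some room to spare,
infinitely often. -/
def oscillationSet (T : α → α) (φ : α → ℝ) (a b : ℝ) : Set α :=
  {x | ∃ m : ℕ, (∃ᶠ n in atTop, birkhoffAverage ℝ T φ n x < a - 1 / ((m : ℝ) + 1)) ∧
    ∃ᶠ n in atTop, b + 1 / ((m : ℝ) + 1) < birkhoffAverage ℝ T φ n x}

/-- Averages at `x` and at `T x` differ by `o(1)`, which the margin `1 / (m + 1)` absorbs after
enlarging `m`. The margin buys exact invariance, so that `T` also preserves the restricted measure.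
-/
theorem preimage_oscillationSet (hb : ∀ x, |φ x| ≤ C) (a b : ℝ) :
    T ⁻¹' oscillationSet T φ a b = oscillationSet T φ a b := by
  have key : ∀ (u v : ℕ → ℝ), Tendsto (fun n => u n - v n) atTop (𝓝 0) →
      (∃ m : ℕ, (∃ᶠ n in atTop, u n < a - 1 / ((m : ℝ) + 1)) ∧
        ∃ᶠ n in atTop, b + 1 / ((m : ℝ) + 1) < u n) →
      (∃ m : ℕ, (∃ᶠ n in atTop, v n < a - 1 / ((m : ℝ) + 1)) ∧
        ∃ᶠ n in atTop, b + 1 / ((m : ℝ) + 1) < v n) := by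
    rintro u v huv ⟨m, h1, h2⟩
    have hm : (0 : ℝ) < 1 / ((m : ℝ) + 1) := by positivity
    obtain ⟨k, hk⟩ := exists_nat_one_div_lt (half_pos hm)
    have hev : ∀ᶠ n in atTop, |u n - v n| < 1 / ((m : ℝ) + 1) / 2 := by
      have := Metric.tendsto_nhds.1 huv _ (half_pos hm)
      simpa using! this
    refine ⟨k, (h1.and_eventually hev).mono ?_, (h2.and_eventually hev).mono ?_⟩
    · rintro n ⟨hn, hn'⟩
      have := abs_lt.1 hn'
      linarith
    · rintro n ⟨hn, hn'⟩
      have := abs_lt.1 hn'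
      linarith
  ext x
  have hlim : Tendsto (fun n => birkhoffAverage ℝ T φ n (T x) - birkhoffAverage ℝ T φ n x)
      atTop (𝓝 0) := by
    refine tendsto_birkhoffAverage_apply_sub_birkhoffAverage ℝ ?_
    refine (isBounded_iff_forall_norm_le.2 ⟨C, ?_⟩)
    rintro _ ⟨n, rfl⟩
    simpa using hb _
  constructor
  · exact key _ _ hlim
  · refine key _ _ ?_
    simpa using hlim.neg

variable [MeasurableSpace α] {μ : Measure α}

theorem measurable_birkhoffSum (hT : Measurable T) (hφ : Measurable φ) (n : ℕ) :
    Measurable (birkhoffSum T φ n) := by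
  unfold birkhoffSum
  exact Finset.measurable_sum _ fun i _ => hφ.comp (hT.iterate i)

theorem measurable_birkhoffAverage (hT : Measurable T) (hφ : Measurable φ) (n : ℕ) :
    Measurable (birkhoffAverage ℝ T φ n) :=
  (measurable_birkhoffSum hT hφ n).const_smul ((n : ℝ)⁻¹)

theorem measurable_maxBirkhoffSum (hT : Measurable T) (hφ : Measurable φ) (N : ℕ) :
    Measurable (maxBirkhoffSum T φ N) := by
  have : Measurable ((Finset.range (N + 1)).sup' ⟨0, by simp⟩ fun k => birkhoffSum T φ k) :=
    Finset.measurable_sup' _ fun k _ => measurable_birkhoffSum hT hφ k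
  convert this using 1
  ext x
  exact (Finset.sup'_apply _ _ _).symm

/-- The maximal ergodic theorem. -/
theorem setIntegral_nonneg_of_maxBirkhoffSum_pos [IsFiniteMeasure μ]
    (hT : MeasurePreserving T μ μ) (hφ : Measurable φ) (hb : ∀ x, |φ x| ≤ C) (N : ℕ) :
    0 ≤ ∫ x in {x | 0 < maxBirkhoffSum T φ N x}, φ x ∂μ := by
  set Φ := maxBirkhoffSum T φ N
  have hΦm : Measurable Φ := measurable_maxBirkhoffSum hT.measurable hφ N
  have hs : MeasurableSet {x | 0 < Φ x} := measurableSet_lt measurable_const hΦm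
  have hΦi : Integrable Φ μ := Integrable.of_bound hΦm.aestronglyMeasurable (N * C)
    (ae_of_all _ fun x => by simpa using abs_maxBirkhoffSum_le hb N x)
  have hΦTi : Integrable (fun x => Φ (T x)) μ := hT.integrable_comp_of_integrable hΦi
  have hφi : Integrable φ μ := Integrable.of_bound hφ.aestronglyMeasurable C
    (ae_of_all _ fun x => by simpa using hb x)
  -- The left side is nonnegative: `Φ` vanishes off the set, `Φ ∘ T` is nonnegative there, and both
  -- have the same total integral.
  have h1 : ∫ x in {x | 0 < Φ x}, (Φ x - Φ (T x)) ∂μ ≤ ∫ x in {x | 0 < Φ x}, φ x ∂μ := by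
    refine setIntegral_mono_on (hΦi.sub hΦTi).integrableOn hφi.integrableOn hs fun x hx => ?_
    have := maxBirkhoffSum_le_add N x hx
    change Φ x ≤ φ x + Φ (T x) at this
    linarith
  have h2 : ∫ x in {x | 0 < Φ x}, Φ x ∂μ = ∫ x, Φ x ∂μ := by
    refine setIntegral_eq_integral_of_forall_compl_eq_zero fun x hx => ?_
    exact le_antisymm (not_lt.1 hx) (maxBirkhoffSum_nonneg N x)
  have h3 : ∫ x in {x | 0 < Φ x}, Φ (T x) ∂μ ≤ ∫ x, Φ (T x) ∂μ :=
    setIntegral_le_integral hΦTi (ae_of_all _ fun x => maxBirkhoffSum_nonneg N (T x))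
  have h4 : ∫ x, Φ (T x) ∂μ = ∫ x, Φ x ∂μ := by
    rw [← integral_map hT.aemeasurable (by rw [hT.map_eq]; exact hΦm.aestronglyMeasurable),
      hT.map_eq]
  rw [integral_sub hΦi.integrableOn hΦTi.integrableOn] at h1
  linarith

theorem integral_nonneg_of_exists_birkhoffSum_pos [IsFiniteMeasure μ]
    (hT : MeasurePreserving T μ μ) (hφ : Measurable φ) (hb : ∀ x, |φ x| ≤ C)
    (h : ∀ᵐ x ∂μ, ∃ n, 0 < birkhoffSum T φ n x) : 0 ≤ ∫ x, φ x ∂μ := by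
  have hφi : Integrable φ μ := Integrable.of_bound hφ.aestronglyMeasurable C
    (ae_of_all _ fun x => by simpa using hb x)
  have hm : Monotone fun N => {x | 0 < maxBirkhoffSum T φ N x} := by
    intro N N' hN x hx
    refine lt_of_lt_of_le (mem_ofPred.1 hx) (Finset.sup'_mono _ ?_ _)
    intro k hk
    simp at hk ⊢
    omega
  have hlim := tendsto_setIntegral_of_monotone (μ := μ) (f := φ)
    (s := fun N => {x | 0 < maxBirkhoffSum T φ N x})
    (fun N => measurableSet_lt measurable_const (measurable_maxBirkhoffSum hT.measurable hφ N))
    hm hφi.integrableOn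
  have hU : (⋃ N, {x | 0 < maxBirkhoffSum T φ N x}) =ᵐ[μ] univ := by
    refine eventuallyEq_univ.2 ?_
    filter_upwards [h] with x hx
    obtain ⟨n, hn⟩ := hx
    refine mem_iUnion.2 ⟨n, lt_of_lt_of_le hn ?_⟩
    exact Finset.le_sup' (fun k => birkhoffSum T φ k x) (by simp)
  rw [setIntegral_congr_set hU, setIntegral_univ] at hlim
  exact ge_of_tendsto' hlim fun N => setIntegral_nonneg_of_maxBirkhoffSum_pos hT hφ hb N

theorem measurableSet_setOf_frequently {p : ℕ → α → Prop} (hp : ∀ n, MeasurableSet {x | p n x}) :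
    MeasurableSet {x | ∃ᶠ n in atTop, p n x} := by
  have : {x | ∃ᶠ n in atTop, p n x} = ⋂ N : ℕ, ⋃ n ≥ N, {x | p n x} := by
    ext x; simp [frequently_atTop]
  rw [this]
  exact MeasurableSet.iInter fun N => MeasurableSet.iUnion fun n => MeasurableSet.iUnion fun _ => hp n

theorem measurableSet_oscillationSet (hT : Measurable T) (hφ : Measurable φ) (a b : ℝ) :
    MeasurableSet (oscillationSet T φ a b) := by
  have h1 : ∀ c : ℝ, MeasurableSet {x | ∃ᶠ n in atTop, birkhoffAverage ℝ T φ n x < c} := fun c =>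
    measurableSet_setOf_frequently
      fun n => measurableSet_lt (measurable_birkhoffAverage hT hφ n) measurable_const
  have h2 : ∀ c : ℝ, MeasurableSet {x | ∃ᶠ n in atTop, c < birkhoffAverage ℝ T φ n x} := fun c =>
    measurableSet_setOf_frequently
      fun n => measurableSet_lt measurable_const (measurable_birkhoffAverage hT hφ n)
  have : oscillationSet T φ a b = ⋃ m : ℕ,
      {x | ∃ᶠ n in atTop, birkhoffAverage ℝ T φ n x < a - 1 / ((m : ℝ) + 1)} ∩
      {x | ∃ᶠ n in atTop, b + 1 / ((m : ℝ) + 1) < birkhoffAverage ℝ T φ n x} := by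
    ext x; simp [oscillationSet]
  rw [this]
  exact MeasurableSet.iUnion fun m => (h1 _).inter (h2 _)

/-- On the invariant set `B`, the maximal ergodic theorem for `φ - b` and `a - φ` gives `b μ(B) ≤
∫_B φ ≤ a μ(B)`, which forces `μ(B) = 0` as `a < b`. -/
theorem measure_oscillationSet [IsFiniteMeasure μ] (hT : MeasurePreserving T μ μ)
    (hφ : Measurable φ) (hb : ∀ x, |φ x| ≤ C) {a b : ℝ} (hab : a < b) :
    μ (oscillationSet T φ a b) = 0 := by
  set B := oscillationSet T φ a b with hB
  have hBm : MeasurableSet B := measurableSet_oscillationSet hT.measurable hφ a b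
  have hTB : MeasurePreserving T (μ.restrict B) (μ.restrict B) := by
    have := hT.restrict_preimage hBm
    rwa [hB, preimage_oscillationSet hb] at this
  have hφi : Integrable φ (μ.restrict B) := Integrable.of_bound hφ.aestronglyMeasurable C
    (ae_of_all _ fun x => by simpa using hb x)
  have hpos : ∀ m : ℕ, (0 : ℝ) < 1 / ((m : ℝ) + 1) := fun m => by positivity
  have h1 : 0 ≤ ∫ x, (φ x - b) ∂(μ.restrict B) := by
    refine integral_nonneg_of_exists_birkhoffSum_pos (C := C + |b|) hTB (hφ.sub_const b)
      (fun x => (abs_sub _ _).trans (by gcongr; exact hb x)) ?_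
    filter_upwards [ae_restrict_mem hBm] with x hx
    obtain ⟨m, -, h⟩ := hx
    obtain ⟨n, hn, hn0⟩ := (h.and_eventually (eventually_gt_atTop 0)).exists
    refine ⟨n, ?_⟩
    have hn' : (0 : ℝ) < n := by exact_mod_cast hn0
    have h3 : b < (n : ℝ)⁻¹ * birkhoffSum T φ n x := by
      have := hpos m
      simp only [birkhoffAverage, smul_eq_mul] at hn
      linarith
    rw [birkhoffSum_sub_const]
    rw [lt_inv_mul_iff₀ hn'] at h3
    linarith
  have h2 : 0 ≤ ∫ x, -(φ x - a) ∂(μ.restrict B) := by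
    refine integral_nonneg_of_exists_birkhoffSum_pos (C := C + |a|) hTB (hφ.sub_const a).neg
      (fun x => by rw [abs_neg]; exact (abs_sub _ _).trans (by gcongr; exact hb x)) ?_
    filter_upwards [ae_restrict_mem hBm] with x hx
    obtain ⟨m, h, -⟩ := hx
    obtain ⟨n, hn, hn0⟩ := (h.and_eventually (eventually_gt_atTop 0)).exists
    refine ⟨n, ?_⟩
    have hn' : (0 : ℝ) < n := by exact_mod_cast hn0
    have h3 : (n : ℝ)⁻¹ * birkhoffSum T φ n x < a := by
      have := hpos m
      simp only [birkhoffAverage, smul_eq_mul] at hn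
      linarith
    have h4 : birkhoffSum T (fun y => -(φ y - a)) n x
        = -birkhoffSum T (fun y => φ y - a) n x := birkhoffSum_neg _ _ _ _
    rw [h4, birkhoffSum_sub_const]
    rw [inv_mul_lt_iff₀ hn'] at h3
    linarith
  rw [integral_neg, integral_sub hφi (integrable_const a)] at h2
  rw [integral_sub hφi (integrable_const b)] at h1
  simp only [integral_const, smul_eq_mul, measureReal_restrict_apply_univ] at h1 h2
  have h5 : μ.real B * (b - a) ≤ 0 := by linarith
  have h6 : μ.real B = 0 := by
    have := measureReal_nonneg (μ := μ) (s := B)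
    nlinarith
  exact (measureReal_eq_zero_iff).1 h6

/-- **Birkhoff's ergodic theorem** for bounded measurable functions: almost everywhere convergence
of the Birkhoff averages. -/
theorem ae_exists_tendsto_birkhoffAverage [IsFiniteMeasure μ] (hT : MeasurePreserving T μ μ)
    (hφ : Measurable φ) (hb : ∀ x, |φ x| ≤ C) :
    ∀ᵐ x ∂μ, ∃ l, Tendsto (fun n => birkhoffAverage ℝ T φ n x) atTop (𝓝 l) := by
  have h : ∀ᵐ x ∂μ, ∀ a b : ℚ, (a : ℝ) < b → x ∉ oscillationSet T φ a b := by
    refine ae_all_iff.2 fun a => ae_all_iff.2 fun b => ?_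
    by_cases hab : (a : ℝ) < b
    · have := measure_oscillationSet hT hφ hb hab
      filter_upwards [measure_eq_zero_iff_ae_notMem.1 this] with x hx _ using hx
    · exact ae_of_all _ fun x h => absurd h hab
  filter_upwards [h] with x hx
  refine tendsto_of_no_upcrossings Rat.isDenseEmbedding_coe_real.dense ?_ ?_ ?_
  · rintro _ ⟨a, rfl⟩ _ ⟨b, rfl⟩ hab ⟨h1, h2⟩
    -- Rationals `a < a' < b' < b` leave the margin that `oscillationSet` demands.
    obtain ⟨a', ha1, ha2⟩ := exists_rat_btwn hab
    obtain ⟨b', hb1, hb2⟩ := exists_rat_btwn ha2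
    obtain ⟨m, hm⟩ := exists_nat_one_div_lt (lt_min (sub_pos.2 ha1) (sub_pos.2 hb2))
    rw [lt_min_iff] at hm
    refine hx a' b' hb1 ⟨m, h1.mono fun n hn => ?_, h2.mono fun n hn => ?_⟩
    · linarith
    · linarith
  · exact ⟨C, eventually_map.2 (Eventually.of_forall fun n =>
      (abs_le.1 (abs_birkhoffAverage_le hb n x)).2)⟩
  · exact ⟨-C, eventually_map.2 (Eventually.of_forall fun n =>
      (abs_le.1 (abs_birkhoffAverage_le hb n x)).1)⟩

theorem integral_birkhoffAverage [IsFiniteMeasure μ] (hT : MeasurePreserving T μ μ)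
    (hφ : Measurable φ) (hb : ∀ x, |φ x| ≤ C) {n : ℕ} (hn : n ≠ 0) :
    ∫ x, birkhoffAverage ℝ T φ n x ∂μ = ∫ x, φ x ∂μ := by
  have hφi : Integrable φ μ := Integrable.of_bound hφ.aestronglyMeasurable C
    (ae_of_all _ fun x => by simpa using hb x)
  have h1 : ∀ k, ∫ x, φ (T^[k] x) ∂μ = ∫ x, φ x ∂μ := fun k => by
    have hk := hT.iterate k
    rw [← integral_map (φ := T^[k]) hk.aemeasurable
      (by rw [hk.map_eq]; exact hφ.aestronglyMeasurable), hk.map_eq]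
  simp only [birkhoffAverage, birkhoffSum, smul_eq_mul]
  rw [integral_const_mul, integral_finsetSum]
  · simp only [h1, Finset.sum_const, Finset.card_range, nsmul_eq_mul]
    field_simp
  · intro k _
    exact (hT.iterate k).integrable_comp_of_integrable hφi

/-- The limit is invariant, hence constant by ergodicity; dominated convergence identifies the
constant. -/
theorem ae_tendsto_birkhoffAverage_of_ergodic [IsProbabilityMeasure μ] (hT : Ergodic T μ)
    (hφ : Measurable φ) (hb : ∀ x, |φ x| ≤ C) :
    ∀ᵐ x ∂μ, Tendsto (fun n => birkhoffAverage ℝ T φ n x) atTop (𝓝 (∫ y, φ y ∂μ)) := by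
  have hmp := hT.toMeasurePreserving
  have h := ae_exists_tendsto_birkhoffAverage hmp hφ hb
  have h' : ∀ᵐ x ∂μ, Tendsto (fun n => birkhoffAverage ℝ T φ n x) atTop
      (𝓝 (limUnder atTop fun n => birkhoffAverage ℝ T φ n x)) := by
    filter_upwards [h] with x hx using tendsto_nhds_limUnder hx
  set g : α → ℝ := fun x => limUnder atTop fun n => birkhoffAverage ℝ T φ n x with hg
  have hgm : AEStronglyMeasurable g μ := aestronglyMeasurable_of_tendsto_ae atTop
    (fun n => (measurable_birkhoffAverage hT.measurable hφ n).aestronglyMeasurable) h'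
  have hinv : g ∘ T =ᵐ[μ] g := by
    filter_upwards [h', hmp.quasiMeasurePreserving.ae h'] with x hx hTx
    have hlim : Tendsto (fun n => birkhoffAverage ℝ T φ n (T x) - birkhoffAverage ℝ T φ n x)
        atTop (𝓝 0) := by
      refine tendsto_birkhoffAverage_apply_sub_birkhoffAverage ℝ ?_
      refine (isBounded_iff_forall_norm_le.2 ⟨C, ?_⟩)
      rintro _ ⟨n, rfl⟩
      simpa using hb _
    have := tendsto_nhds_unique hlim (hTx.sub hx)
    simp only [Function.comp]
    linarith
  obtain ⟨c, hc⟩ := hT.ae_eq_const_of_ae_eq_comp_ae hgm hinv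
  have hdom : Tendsto (fun n => ∫ x, birkhoffAverage ℝ T φ n x ∂μ) atTop (𝓝 (∫ x, g x ∂μ)) := by
    refine tendsto_integral_of_dominated_convergence (fun _ => C)
      (fun n => (measurable_birkhoffAverage hT.measurable hφ n).aestronglyMeasurable)
      (integrable_const C) (fun n => ae_of_all _ fun x => ?_) h'
    simpa using abs_birkhoffAverage_le hb n x
  have hconst : Tendsto (fun n => ∫ x, birkhoffAverage ℝ T φ n x ∂μ) atTop
      (𝓝 (∫ x, φ x ∂μ)) := by
    refine tendsto_const_nhds.congr' ?_
    filter_upwards [eventually_ne_atTop 0] with n hn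
      using (integral_birkhoffAverage hmp hφ hb hn).symm
  have hgint : ∫ x, g x ∂μ = c := by
    rw [integral_congr_ae hc]; simp
  have hceq : c = ∫ x, φ x ∂μ := by
    rw [← hgint]; exact tendsto_nhds_unique hdom hconst
  filter_upwards [h', hc] with x hx hcx
  rwa [show (limUnder atTop fun n => birkhoffAverage ℝ T φ n x) = ∫ y, φ y ∂μ from
    hcx.trans hceq] at hx

end Birkhoff

/-! ### Weak* limits of measures on compact spaces -/

theorem measure_eq_of_integral_continuousMap_eq {Y : Type*} [TopologicalSpace Y]
    [MeasurableSpace Y] [BorelSpace Y] [HasOuterApproxClosed Y] {μ ν : Measure Y}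
    [IsFiniteMeasure μ] [IsFiniteMeasure ν]
    (h : ∀ φ : C(Y, ℝ), ∫ y, φ y ∂μ = ∫ y, φ y ∂ν) : μ = ν :=
  ext_of_forall_integral_eq_of_IsFiniteMeasure fun φ => h φ.toContinuousMap

section WeakConvergence

variable {Y : Type*} [TopologicalSpace Y] [CompactSpace Y] [MeasurableSpace Y] [BorelSpace Y]

theorem integrable_continuousMap (φ : C(Y, ℝ)) (μ : Measure Y) [IsFiniteMeasure μ] :
    Integrable φ μ :=
  Integrable.of_bound φ.continuous.measurable.aestronglyMeasurable ‖φ‖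
    (ae_of_all _ fun y => φ.norm_coe_le_norm y)

theorem tendsto_integral_continuousMap {ι : Type*} {l : Filter ι} {η : ι → ProbabilityMeasure Y}
    {η₀ : ProbabilityMeasure Y} (h : Tendsto η l (𝓝 η₀)) (φ : C(Y, ℝ)) :
    Tendsto (fun i => ∫ y, φ y ∂(η i : Measure Y)) l (𝓝 (∫ y, φ y ∂(η₀ : Measure Y))) := by
  have := ProbabilityMeasure.tendsto_iff_forall_integral_tendsto.1 h
    (BoundedContinuousFunction.mkOfCompact φ)
  simpa using this

theorem tendsto_integral_of_tendstoUniformly {ι : Type*} {l : Filter ι}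
    {η : ι → ProbabilityMeasure Y} {η₀ : ProbabilityMeasure Y} (h : Tendsto η l (𝓝 η₀))
    {ψ : ι → C(Y, ℝ)} {ψ₀ : C(Y, ℝ)} (hψ : Tendsto ψ l (𝓝 ψ₀)) :
    Tendsto (fun i => ∫ y, ψ i y ∂(η i : Measure Y)) l (𝓝 (∫ y, ψ₀ y ∂(η₀ : Measure Y))) := by
  have h1 := tendsto_integral_continuousMap h ψ₀
  have h2 : Tendsto (fun i => ∫ y, ψ i y ∂(η i : Measure Y) - ∫ y, ψ₀ y ∂(η i : Measure Y)) l
      (𝓝 0) := by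
    refine squeeze_zero_norm (fun i => ?_) (tendsto_iff_norm_sub_tendsto_zero.1 hψ)
    rw [← integral_sub (integrable_continuousMap _ _) (integrable_continuousMap _ _)]
    refine (norm_integral_le_of_norm_le_const (C := ‖ψ i - ψ₀‖) (ae_of_all _ fun y => ?_)).trans ?_
    · exact (ψ i - ψ₀).norm_coe_le_norm y
    · simp
  simpa using h2.add h1

/-- Asymptotic invariance is all that a limit needs. This form covers both empirical measures of a
fixed map and invariant measures of varying maps. -/
theorem measurePreserving_of_tendsto [HasOuterApproxClosed Y] {ι : Type*} {l : Filter ι} [l.NeBot]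
    {η : ι → ProbabilityMeasure Y} {η₀ : ProbabilityMeasure Y} (h : Tendsto η l (𝓝 η₀))
    {S : ι → C(Y, Y)} {S₀ : C(Y, Y)} (hS : Tendsto S l (𝓝 S₀))
    (hinv : ∀ φ : C(Y, ℝ), Tendsto (fun i => ∫ y, φ (S i y) ∂(η i : Measure Y)
      - ∫ y, φ y ∂(η i : Measure Y)) l (𝓝 0)) :
    MeasurePreserving S₀ (η₀ : Measure Y) (η₀ : Measure Y) := by
  refine ⟨S₀.continuous.measurable, ?_⟩
  have := Measure.isProbabilityMeasure_map (μ := (η₀ : Measure Y))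
    S₀.continuous.measurable.aemeasurable
  refine measure_eq_of_integral_continuousMap_eq fun φ => ?_
  rw [integral_map S₀.continuous.measurable.aemeasurable
    φ.continuous.measurable.aestronglyMeasurable]
  have h1 := tendsto_integral_of_tendstoUniformly h
    (((ContinuousMap.continuous_postcomp φ).tendsto S₀).comp hS)
  have h2 := h1.sub (tendsto_integral_continuousMap h φ)
  exact sub_eq_zero.1 (tendsto_nhds_unique h2 (hinv φ))

end WeakConvergence

/-! ### Typical points of ergodic measures -/

section Generic

variable {X : Type*} [TopologicalSpace X] [MeasurableSpace X]

/-- `x` is typical for `μ`: the time averages of all continuous functions along the orbit of `x`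
converge to their space averages. -/
def IsTypicalPoint (T : X → X) (μ : Measure X) (x : X) : Prop :=
  ∀ φ : C(X, ℝ), Tendsto (fun n => birkhoffAverage ℝ T φ n x) atTop (𝓝 (∫ y, φ y ∂μ))

/-- `C(X, ℝ)` is separable: Birkhoff's theorem for a countable dense set of functions extends to all
by an `ε / 3` argument. -/
theorem ae_isTypicalPoint [CompactSpace X] [T2Space X] [SecondCountableTopology X] [BorelSpace X]
    {T : X → X} {μ : Measure X} [IsProbabilityMeasure μ] (hT : Ergodic T μ) :
    ∀ᵐ x ∂μ, IsTypicalPoint T μ x := by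
  have h : ∀ᵐ x ∂μ, ∀ k : ℕ, Tendsto
      (fun n => birkhoffAverage ℝ T (TopologicalSpace.denseSeq C(X, ℝ) k) n x) atTop
      (𝓝 (∫ y, TopologicalSpace.denseSeq C(X, ℝ) k y ∂μ)) := by
    refine ae_all_iff.2 fun k => ?_
    set φ := TopologicalSpace.denseSeq C(X, ℝ) k
    exact ae_tendsto_birkhoffAverage_of_ergodic hT φ.continuous.measurable
      (fun y => φ.norm_coe_le_norm y)
  filter_upwards [h] with x hx φ
  rw [Metric.tendsto_atTop]
  intro ε hε
  obtain ⟨k, hk⟩ := (TopologicalSpace.denseRange_denseSeq C(X, ℝ)).exists_dist_lt φ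
    (show 0 < ε / 3 by positivity)
  set ψ := TopologicalSpace.denseSeq C(X, ℝ) k with hψ
  obtain ⟨N, hN⟩ := Metric.tendsto_atTop.1 (hx k) (ε / 3) (by positivity)
  rw [dist_eq_norm] at hk
  have h1 : ∀ n, |birkhoffAverage ℝ T φ n x - birkhoffAverage ℝ T ψ n x| ≤ ‖φ - ψ‖ := fun n => by
    have h2 : birkhoffAverage ℝ T φ n x - birkhoffAverage ℝ T ψ n x
        = birkhoffAverage ℝ T (φ - ψ : C(X, ℝ)) n x := by
      rw [ContinuousMap.coe_sub, birkhoffAverage_sub]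
      rfl
    rw [h2]
    exact abs_birkhoffAverage_le (fun y => (φ - ψ).norm_coe_le_norm y) n x
  have h3 : |∫ y, φ y ∂μ - ∫ y, ψ y ∂μ| ≤ ‖φ - ψ‖ := by
    rw [← integral_sub (integrable_continuousMap _ _) (integrable_continuousMap _ _),
      ← Real.norm_eq_abs]
    refine (norm_integral_le_of_norm_le_const (C := ‖φ - ψ‖) (ae_of_all _ fun y => ?_)).trans ?_
    · exact (φ - ψ).norm_coe_le_norm y
    · simp
  refine ⟨N, fun n hn => ?_⟩
  have h4 := hN n hn
  rw [Real.dist_eq] at h4 ⊢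
  rw [← hψ] at h4
  have h5 := abs_le.1 (h1 n)
  have h6 := abs_le.1 h3
  have h7 := abs_lt.1 h4
  rw [abs_lt]
  constructor <;> linarith

end Generic

/-! ### Invariant lifts to extensions -/

section Lift

variable {Y : Type*} [MeasurableSpace Y]

/-- The empirical measure of the first `n + 1` points of the orbit of `y`. -/
noncomputable def empiricalMeasure (S : Y → Y) (y : Y) (n : ℕ) : Measure Y :=
  ((n : ℝ≥0∞) + 1)⁻¹ • ∑ k ∈ Finset.range (n + 1), Measure.dirac (S^[k] y)

instance isProbabilityMeasure_empiricalMeasure (S : Y → Y) (y : Y) (n : ℕ) :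
    IsProbabilityMeasure (empiricalMeasure S y n) := by
  constructor
  simp [empiricalMeasure]
  refine ENNReal.inv_mul_cancel (by simp) ?_
  simp

theorem integral_empiricalMeasure (S : Y → Y) (y : Y) (n : ℕ) {φ : Y → ℝ} (hφ : Measurable φ) :
    ∫ z, φ z ∂(empiricalMeasure S y n) = birkhoffAverage ℝ S φ (n + 1) y := by
  rw [empiricalMeasure, integral_smul_measure, integral_finsetSum_measure]
  · simp only [integral_dirac' φ _ hφ.stronglyMeasurable, birkhoffAverage, birkhoffSum]
    congr 1
    rw [ENNReal.toReal_inv, ENNReal.toReal_add (by simp) (by simp)]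
    simp
  · intro k _
    exact integrable_dirac' hφ.stronglyMeasurable (by simp)

variable [TopologicalSpace Y] [CompactSpace Y] [T2Space Y] [HasOuterApproxClosed Y] [BorelSpace Y]
  {X : Type*} [TopologicalSpace X] [HasOuterApproxClosed X]
  [MeasurableSpace X] [BorelSpace X]

/-- If `S` on `Y` is an extension of `T` on `X`, and `y₀` lies over a typical point of `μ`, then `μ`
lifts to an invariant measure of `S` that gives the time averages along the orbit of `y₀`. -/
theorem exists_invariant_lift {S : C(Y, Y)} {T : X → X} {q : C(Y, X)} (hq : ∀ y, q (S y) = T (q y))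
    {μ : Measure X} [IsProbabilityMeasure μ] {y₀ : Y} (hy₀ : IsTypicalPoint T μ (q y₀)) :
    ∃ η : ProbabilityMeasure Y, MeasurePreserving S (η : Measure Y) (η : Measure Y) ∧
      (η : Measure Y).map q = μ ∧
      ∀ (ψ : C(Y, ℝ)) (l : ℝ), Tendsto (fun n => birkhoffAverage ℝ S ψ n y₀) atTop (𝓝 l) →
        ∫ y, ψ y ∂(η : Measure Y) = l := by
  let em : ℕ → ProbabilityMeasure Y := fun n => ⟨empiricalMeasure S y₀ n, inferInstance⟩
  -- An ultrafilter finer than `atTop` makes the empirical measures converge by compactness alone,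
  -- and preserves every limit along `atTop`.
  let u : Ultrafilter ℕ := Ultrafilter.of atTop
  have hu : (u : Filter ℕ) ≤ atTop := Ultrafilter.of_le atTop
  obtain ⟨η, -, hη⟩ := isCompact_univ.ultrafilter_le_nhds (u.map em) (by simp)
  have hη' : Tendsto em u (𝓝 η) := hη
  have hint : ∀ (ψ : C(Y, ℝ)) (l : ℝ),
      Tendsto (fun n => birkhoffAverage ℝ S ψ n y₀) atTop (𝓝 l) →
      ∫ y, ψ y ∂(η : Measure Y) = l := by
    intro ψ l hl
    have h1 := tendsto_integral_continuousMap hη' ψ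
    have h2 : Tendsto (fun n => ∫ y, ψ y ∂(em n : Measure Y)) u (𝓝 l) := by
      have h3 := ((tendsto_add_atTop_iff_nat 1).2 hl).mono_left hu
      refine h3.congr fun n => ?_
      exact (integral_empiricalMeasure S y₀ n ψ.continuous.measurable).symm
    exact tendsto_nhds_unique h1 h2
  refine ⟨η, ?_, ?_, hint⟩
  · refine measurePreserving_of_tendsto hη' (S := fun _ => S) tendsto_const_nhds fun φ => ?_
    have h1 : Tendsto (fun n => birkhoffAverage ℝ S φ n (S y₀) - birkhoffAverage ℝ S φ n y₀)
        atTop (𝓝 0) := by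
      refine tendsto_birkhoffAverage_apply_sub_birkhoffAverage ℝ ?_
      refine (isBounded_iff_forall_norm_le.2 ⟨‖φ‖, ?_⟩)
      rintro _ ⟨n, rfl⟩
      exact φ.norm_coe_le_norm _
    have h2 := ((tendsto_add_atTop_iff_nat 1).2 h1).mono_left hu
    refine h2.congr fun n => ?_
    have h3 := integral_empiricalMeasure S y₀ n φ.continuous.measurable
    have h4 := integral_empiricalMeasure S y₀ n (φ.comp S).continuous.measurable
    have h5 : birkhoffAverage ℝ S φ (n + 1) (S y₀)
        = birkhoffAverage ℝ S (φ.comp S : C(Y, ℝ)) (n + 1) y₀ := by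
      simp only [birkhoffAverage, birkhoffSum, ContinuousMap.comp_apply,
        ← Function.iterate_succ_apply, ← Function.iterate_succ_apply']
    rw [h5, ← h4, ← h3]
    rfl
  · have := Measure.isProbabilityMeasure_map (μ := (η : Measure Y))
      q.continuous.measurable.aemeasurable
    refine measure_eq_of_integral_continuousMap_eq fun φ => ?_
    rw [integral_map q.continuous.measurable.aemeasurable
      φ.continuous.measurable.aestronglyMeasurable]
    -- Averages of `φ ∘ q` along `y₀` are averages of `φ` along the typical point `q y₀`, so they
    -- tend to `∫ φ dμ`.
    refine hint (φ.comp q) _ ((hy₀ φ).congr fun n => ?_)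
    have hit : ∀ k, q (S^[k] y₀) = T^[k] (q y₀) := fun k =>
      (Function.Semiconj.iterate_right (f := q) hq k) y₀
    simp [birkhoffAverage, birkhoffSum, hit]

end Lift

/-! ### Exponential growth rates -/

section Growth

open Asymptotics

/-- The sequence `s` grows at exponential rate at most `Λ`. -/
def GrowthLE (s : ℕ → ℝ) (Λ : ℝ) : Prop :=
  ∀ ε > 0, s =O[atTop] fun n : ℕ => Real.exp (n * (Λ + ε))

variable {s t : ℕ → ℝ} {Λ Λ' l : ℝ}

theorem GrowthLE.mono (h : GrowthLE s Λ) (hΛ : Λ ≤ Λ') : GrowthLE s Λ' := fun ε hε =>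
  (h ε hε).trans <| IsBigO.of_bound 1 <| Eventually.of_forall fun n => by
    simp only [Real.norm_eq_abs, Real.abs_exp, one_mul]
    gcongr

theorem GrowthLE.trans_isBigO (h : GrowthLE t Λ) (hst : s =O[atTop] t) : GrowthLE s Λ :=
  fun ε hε => hst.trans (h ε hε)

theorem GrowthLE.add (hs : GrowthLE s Λ) (ht : GrowthLE t Λ) :
    GrowthLE (fun n => s n + t n) Λ := fun ε hε => (hs ε hε).add (ht ε hε)

theorem GrowthLE.abs (hs : GrowthLE s Λ) : GrowthLE (fun n => |s n|) Λ :=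
  fun ε hε => (hs ε hε).abs_left

theorem GrowthLE.sum {ι : Type*} {S : Finset ι} {f : ι → ℕ → ℝ}
    (h : ∀ i ∈ S, GrowthLE (f i) Λ) : GrowthLE (fun n => ∑ i ∈ S, f i n) Λ :=
  fun ε hε => IsBigO.fun_sum fun i hi => h i hi ε hε

theorem GrowthLE.mul (hs : GrowthLE s Λ) (ht : GrowthLE t Λ') :
    GrowthLE (fun n => s n * t n) (Λ + Λ') := fun ε hε => by
  refine ((hs (ε / 2) (by positivity)).mul (ht (ε / 2) (by positivity))).congr_right fun n => ?_
  rw [← Real.exp_add]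
  congr 1
  ring

theorem growthLE_zero_of_bounded {B : ℝ} (h : ∀ n, |s n| ≤ B) : GrowthLE s 0 := fun ε hε => by
  have hB : 0 ≤ B := (abs_nonneg _).trans (h 0)
  refine IsBigO.of_bound B (Eventually.of_forall fun n => ?_)
  rw [Real.norm_eq_abs, Real.norm_eq_abs, Real.abs_exp]
  have : (1 : ℝ) ≤ Real.exp (n * (0 + ε)) := Real.one_le_exp (by positivity)
  nlinarith [h n]

theorem GrowthLE.bounded_mul {B : ℝ} (h : ∀ n, |s n| ≤ B) (ht : GrowthLE t Λ) :
    GrowthLE (fun n => s n * t n) Λ := by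
  simpa using (growthLE_zero_of_bounded h).mul ht

theorem GrowthLE.exists_bound (h : GrowthLE s Λ) {ε : ℝ} (hε : 0 < ε) :
    ∃ C > 0, ∀ n : ℕ, |s n| ≤ C * Real.exp (n * (Λ + ε)) := by
  obtain ⟨C, hC, hb⟩ := bound_of_isBigO_nat_atTop (h ε hε)
  exact ⟨C, hC, fun n => by simpa using hb (x := n) (Real.exp_pos _).ne'⟩

theorem GrowthLE.tendsto_zero (h : GrowthLE s Λ) (hΛ : Λ < 0) : Tendsto s atTop (𝓝 0) := by
  refine (h (-Λ / 2) (by linarith)).trans_tendsto ?_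
  refine Real.tendsto_exp_atBot.comp ?_
  exact tendsto_natCast_atTop_atTop.atTop_mul_const_of_neg (by linarith)

/-- Polynomial factors do not change the exponential growth rate. -/
theorem GrowthLE.natCast_mul (h : GrowthLE s Λ) : GrowthLE (fun n => (n : ℝ) * s n) Λ := by
  have h1 : GrowthLE (fun n => (n : ℝ)) 0 := fun ε hε => by
    refine IsBigO.of_bound ε⁻¹ (Eventually.of_forall fun n => ?_)
    rw [Real.norm_eq_abs, Real.norm_eq_abs, Real.abs_exp, Nat.abs_cast, le_inv_mul_iff₀ hε]
    have := Real.add_one_le_exp (n * (0 + ε))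
    linarith
  simpa using h1.mul h

theorem GrowthLE.sum_range (h : GrowthLE s Λ) (hΛ : 0 ≤ Λ) :
    GrowthLE (fun n => ∑ j ∈ Finset.range n, s j) Λ := by
  intro ε hε
  obtain ⟨C, hC, hb⟩ := h.exists_bound (show 0 < ε / 2 by positivity)
  have h1 : GrowthLE (fun n : ℕ => (n : ℝ) * Real.exp (n * (Λ + ε / 2))) (Λ + ε / 2) := by
    refine GrowthLE.natCast_mul fun δ hδ => IsBigO.of_bound 1 (Eventually.of_forall fun n => ?_)
    simp only [Real.norm_eq_abs, Real.abs_exp, one_mul]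
    exact Real.exp_le_exp.2 (mul_le_mul_of_nonneg_left (by linarith) n.cast_nonneg)
  have h2 := h1 (ε / 2) (by positivity)
  refine IsBigO.trans (IsBigO.of_bound C (Eventually.of_forall fun n => ?_))
    (h2.congr_right fun n => by ring_nf)
  rw [Real.norm_eq_abs, Real.norm_eq_abs, abs_of_nonneg (a := _ * Real.exp _) (by positivity)]
  calc |∑ j ∈ Finset.range n, s j| ≤ ∑ j ∈ Finset.range n, |s j| := Finset.abs_sum_le_sum_abs _ _
    _ ≤ ∑ j ∈ Finset.range n, C * Real.exp (n * (Λ + ε / 2)) := by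
        refine Finset.sum_le_sum fun j hj => (hb j).trans ?_
        have : (j : ℝ) ≤ n := by exact_mod_cast (Finset.mem_range.1 hj).le
        gcongr
    _ = C * (n * Real.exp (n * (Λ + ε / 2))) := by
        simp only [Finset.sum_const, Finset.card_range, nsmul_eq_mul]; ring

theorem GrowthLE.summable (h : GrowthLE s Λ) (hΛ : Λ < 0) : Summable s := by
  obtain ⟨C, hC, hb⟩ := h.exists_bound (show 0 < -Λ / 2 by linarith)
  refine Summable.of_norm_bounded (g := fun n : ℕ => C * Real.exp (n * (Λ + -Λ / 2))) ?_ hb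
  exact (Real.summable_exp_nat_mul_iff.2 (by linarith)).mul_left C

theorem GrowthLE.tsum_tail (h : GrowthLE s Λ) (hΛ : Λ < 0) :
    GrowthLE (fun n => ∑' k, s (k + n)) Λ := by
  have key : ∀ ε > 0, Λ + ε < 0 →
      (fun n => ∑' k, s (k + n)) =O[atTop] fun n : ℕ => Real.exp (n * (Λ + ε)) := by
    intro ε hε hneg
    obtain ⟨C, hC, hb⟩ := h.exists_bound hε
    have hsum : Summable fun k : ℕ => Real.exp (k * (Λ + ε)) :=
      Real.summable_exp_nat_mul_iff.2 hneg
    refine IsBigO.of_bound (C * ∑' k : ℕ, Real.exp (k * (Λ + ε)))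
      (Eventually.of_forall fun n => ?_)
    rw [Real.norm_eq_abs (Real.exp _), Real.abs_exp]
    refine (tsum_of_norm_bounded (g := fun k : ℕ => C * Real.exp (n * (Λ + ε)) *
      Real.exp (k * (Λ + ε))) (hsum.mul_left _).hasSum fun k => ?_).trans (le_of_eq ?_)
    · refine (hb (k + n)).trans (le_of_eq ?_)
      rw [mul_assoc, ← Real.exp_add]
      push_cast
      ring_nf
    · rw [tsum_mul_left]; ring
  intro ε hε
  -- The bound weakens as `ε` grows, so it is enough to treat an `ε` small enough for the geometric
  -- series to converge.
  have h1 : 0 < min ε (-Λ / 2) := lt_min hε (by linarith)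
  refine (key _ h1 ?_).trans (IsBigO.of_bound 1 (Eventually.of_forall fun n => ?_))
  · have := min_le_right ε (-Λ / 2)
    linarith
  · simp only [Real.norm_eq_abs, Real.abs_exp, one_mul]
    gcongr
    exact min_le_left _ _

theorem growthLE_exp_of_tendsto (h : Tendsto (fun n : ℕ => (n : ℝ)⁻¹ * s n) atTop (𝓝 l)) :
    GrowthLE (fun n => Real.exp (s n)) l := fun ε hε => by
  refine IsBigO.of_bound 1 ?_
  filter_upwards [h.eventually (gt_mem_nhds (lt_add_of_pos_right l hε)), eventually_gt_atTop 0]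
    with n hn hn0
  have hn' : (0 : ℝ) < n := by exact_mod_cast hn0
  simp only [Real.norm_eq_abs, Real.abs_exp, one_mul]
  gcongr
  rw [inv_mul_lt_iff₀ hn'] at hn
  exact hn.le

theorem growthLE_exp_neg_of_tendsto (h : Tendsto (fun n : ℕ => (n : ℝ)⁻¹ * s n) atTop (𝓝 l)) :
    GrowthLE (fun n => Real.exp (-s n)) (-l) :=
  growthLE_exp_of_tendsto (by simpa using h.neg)

theorem growthLE_of_tendsto_log (hs : ∀ n, 0 < s n)
    (h : Tendsto (fun n : ℕ => (n : ℝ)⁻¹ * Real.log (s n)) atTop (𝓝 l)) : GrowthLE s l := by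
  simpa [Real.exp_log (hs _)] using growthLE_exp_of_tendsto h

theorem growthLE_inv_of_tendsto_log (hs : ∀ n, 0 < s n)
    (h : Tendsto (fun n : ℕ => (n : ℝ)⁻¹ * Real.log (s n)) atTop (𝓝 l)) :
    GrowthLE (fun n => (s n)⁻¹) (-l) := by
  simpa [Real.exp_neg, Real.exp_log (hs _)] using growthLE_exp_neg_of_tendsto h

theorem GrowthLE.eventually_log_lt (hs : ∀ n, 0 < s n) (h : GrowthLE s l) {a : ℝ} (ha : l < a) :
    ∀ᶠ n : ℕ in atTop, (n : ℝ)⁻¹ * Real.log (s n) < a := by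
  obtain ⟨C, hC, hb⟩ := h.exists_bound (show 0 < (a - l) / 2 by linarith)
  have h1 : Tendsto (fun n : ℕ => (n : ℝ)⁻¹ * Real.log C) atTop (𝓝 0) := by
    simpa using tendsto_inv_atTop_nhds_zero_nat.mul_const (Real.log C)
  filter_upwards [h1.eventually (gt_mem_nhds (show 0 < (a - l) / 2 by linarith)),
    eventually_gt_atTop 0] with n hn hn0
  have hn' : (0 : ℝ) < n := by exact_mod_cast hn0
  have h2 : Real.log (s n) ≤ Real.log C + n * (l + (a - l) / 2) := by
    rw [← Real.log_exp (n * (l + (a - l) / 2)), ← Real.log_mul hC.ne' (Real.exp_pos _).ne']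
    exact Real.log_le_log (hs n) ((le_abs_self _).trans (hb n))
  calc (n : ℝ)⁻¹ * Real.log (s n) ≤ (n : ℝ)⁻¹ * (Real.log C + n * (l + (a - l) / 2)) := by gcongr
    _ = (n : ℝ)⁻¹ * Real.log C + (l + (a - l) / 2) := by field_simp
    _ < a := by linarith

/-- The rate of `s` bounds the limsup, and the rate of its inverse bounds the liminf. -/
theorem tendsto_log_of_growthLE (hs : ∀ n, 0 < s n) (h : GrowthLE s l)
    (h' : GrowthLE (fun n => (s n)⁻¹) (-l)) :
    Tendsto (fun n : ℕ => (n : ℝ)⁻¹ * Real.log (s n)) atTop (𝓝 l) := by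
  refine tendsto_order.2 ⟨fun a ha => ?_, fun a ha => h.eventually_log_lt hs ha⟩
  filter_upwards [h'.eventually_log_lt (fun n => inv_pos.2 (hs n)) (neg_lt_neg ha)] with n hn
  rw [Real.log_inv] at hn
  linarith

theorem tendsto_log_of_isTheta (hs : ∀ n, 0 < s n) (ht : ∀ n, 0 < t n)
    (hst : s =O[atTop] t) (hts : t =O[atTop] s)
    (h : Tendsto (fun n : ℕ => (n : ℝ)⁻¹ * Real.log (s n)) atTop (𝓝 l)) :
    Tendsto (fun n : ℕ => (n : ℝ)⁻¹ * Real.log (t n)) atTop (𝓝 l) := by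
  refine tendsto_log_of_growthLE ht ((growthLE_of_tendsto_log hs h).trans_isBigO hts)
    ((growthLE_inv_of_tendsto_log hs h).trans_isBigO ?_)
  exact hst.inv_rev (Eventually.of_forall fun n hn => absurd hn (hs n).ne')

end Growth

/-! ### Exact exponents of triangular linear recurrences -/

section Triangular

variable {r : ℕ → ℝ} {Λ l : ℝ}

/-- A scalar linear recurrence with forcing of exponential rate at most `Λ` has a solution
of exponential rate at most `Λ`. -/
theorem exists_scalar_solution (hr : ∀ n, 0 < r n)
    (hl : Tendsto (fun n : ℕ => (n : ℝ)⁻¹ * ∑ k ∈ Finset.range n, Real.log (r k)) atTop (𝓝 l))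
    {g : ℕ → ℝ} (hg : GrowthLE g Λ) :
    ∃ y : ℕ → ℝ, (∀ n, y (n + 1) = r n * y n + g n) ∧ GrowthLE y Λ := by
  set P : ℕ → ℝ := fun n => Real.exp (∑ k ∈ Finset.range n, Real.log (r k)) with hP
  have hPs : ∀ n, P (n + 1) = r n * P n := fun n => by
    simp only [hP, Finset.sum_range_succ, Real.exp_add, Real.exp_log (hr n)]
    ring
  have hP0 : ∀ n, P n ≠ 0 := fun n => (Real.exp_pos _).ne'
  have hPg : GrowthLE P l := growthLE_exp_of_tendsto hl
  have hPi : GrowthLE (fun n => (P (n + 1))⁻¹) (-l) := by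
    have h1 : GrowthLE (fun n => (P n)⁻¹) (-l) := by
      simpa [hP, Real.exp_neg] using growthLE_exp_neg_of_tendsto hl
    intro ε hε
    have h2 := (h1 ε hε).comp_tendsto (tendsto_add_atTop_nat 1)
    refine h2.trans (Asymptotics.IsBigO.of_bound (Real.exp (-l + ε))
      (Eventually.of_forall fun n => ?_))
    simp only [Function.comp, Real.norm_eq_abs, Real.abs_exp]
    rw [← Real.exp_add]
    push_cast
    ring_nf
    rfl
  set h : ℕ → ℝ := fun n => g n * (P (n + 1))⁻¹ with hh
  have hhg : GrowthLE h (Λ + -l) := hg.mul hPi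
  have hPh : ∀ n, P (n + 1) * h n = g n := fun n => by
    simp only [hh]
    field_simp [hP0 (n + 1)]
  -- Variation of constants with homogeneous solution `P`. If `l ≤ Λ`, the solution starting at `0`
  -- sums the past forcing. If `l > Λ`, that sum could pick up growth at rate `l`; the convergent
  -- sum over future forcing cancels it.
  rcases le_or_gt l Λ with hle | hlt
  · refine ⟨fun n => P n * ∑ j ∈ Finset.range n, h j, fun n => ?_, ?_⟩
    · beta_reduce
      rw [Finset.sum_range_succ, mul_add, hPh, hPs]
      ring
    · have := hPg.mul (hhg.sum_range (by linarith))
      simpa using this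
  · have hneg : Λ + -l < 0 := by linarith
    have hsum := hhg.summable hneg
    refine ⟨fun n => -(P n * ∑' k, h (k + n)), fun n => ?_, ?_⟩
    · have h1 : ∑' k, h (k + n) = h n + ∑' k, h (k + (n + 1)) := by
        rw [((summable_nat_add_iff n).2 hsum).tsum_eq_zero_add]
        simp only [zero_add]
        congr 1
        exact tsum_congr fun k => by ring_nf
      beta_reduce
      rw [h1]
      linear_combination hPh n - (h n + ∑' k, h (k + (n + 1))) * hPs n
    · have := hPg.mul (hhg.tsum_tail hneg)
      have h2 : GrowthLE (fun n => -(P n * ∑' k, h (k + n))) (l + (Λ + -l)) :=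
        fun ε hε => (this ε hε).neg_left
      simpa using h2

variable {R : ℕ → ℕ → ℕ → ℝ} {lam : ℕ → ℝ} {B : ℝ}

/-- An upper triangular linear recurrence, whose diagonal entries have exact exponents, with forcing
of exponential rate at most `Λ` has a solution of exponential rate at most `Λ`. -/
theorem exists_triangular_solution (d : ℕ) (hR : ∀ n i k, |R n i k| ≤ B)
    (hpos : ∀ n, ∀ i < d, 0 < R n i i)
    (hlam : ∀ i < d, Tendsto (fun n : ℕ => (n : ℝ)⁻¹ * ∑ k ∈ Finset.range n, Real.log (R k i i))
      atTop (𝓝 (lam i)))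
    {g : ℕ → ℕ → ℝ} (hg : ∀ i < d, GrowthLE (fun n => g n i) Λ) :
    ∃ y : ℕ → ℕ → ℝ, (∀ n, ∀ i < d, y (n + 1) i = ∑ k ∈ Finset.Ico i d, R n i k * y n k + g n i) ∧
      ∀ i < d, GrowthLE (fun n => y n i) Λ := by
  induction d generalizing g with
  | zero => exact ⟨fun _ _ => 0, by simp, by simp⟩
  | succ d ih =>
    -- Back substitution: the last coordinate evolves alone, and then acts as additional forcing on
    -- the others.
    obtain ⟨z, hz, hzg⟩ := exists_scalar_solution (fun n => hpos n d (by omega))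
      (hlam d (by omega)) (hg d (by omega))
    obtain ⟨y, hy, hyg⟩ := ih (fun n i hi => hpos n i (by omega)) (fun i hi => hlam i (by omega))
      (g := fun n i => R n i d * z n + g n i)
      (fun i hi => (GrowthLE.bounded_mul (fun n => hR n i d) hzg).add (hg i (by omega)))
    refine ⟨fun n i => if i = d then z n else y n i, fun n i hi => ?_, fun i hi => ?_⟩
    · rcases Nat.lt_succ_iff_lt_or_eq.1 hi with hi' | rfl
      · beta_reduce
        rw [if_neg hi'.ne, Finset.sum_Ico_succ_top hi'.le, if_pos rfl, hy n i hi']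
        have hs : ∑ k ∈ Finset.Ico i d, R n i k * (if k = d then z n else y n k)
            = ∑ k ∈ Finset.Ico i d, R n i k * y n k :=
          Finset.sum_congr rfl fun k hk => by rw [if_neg (Finset.mem_Ico.1 hk).2.ne]
        rw [hs]
        ring
      · simp [hz]
    · rcases Nat.lt_succ_iff_lt_or_eq.1 hi with hi' | rfl
      · simpa [hi'.ne] using hyg i hi'
      · simpa using hzg

/-- Induction on `d`. If the last coordinate is not identically zero, it has exponent `lam d` and
forces the others. Subtracting a particular response `z` of rate at most `lam d` leaves a
homogeneous solution `w` in dimension `d`, which vanishes or has an exact exponent `l` by induction.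
The exponent of `y` is `lam d` or `max (lam d) l` respectively. -/
theorem tendsto_log_triangular_solution (d : ℕ) (hR : ∀ n i k, |R n i k| ≤ B)
    (hpos : ∀ n, ∀ i < d, 0 < R n i i)
    (hlam : ∀ i < d, Tendsto (fun n : ℕ => (n : ℝ)⁻¹ * ∑ k ∈ Finset.range n, Real.log (R k i i))
      atTop (𝓝 (lam i)))
    {y : ℕ → ℕ → ℝ} (hy : ∀ n, ∀ i < d, y (n + 1) i = ∑ k ∈ Finset.Ico i d, R n i k * y n k)
    (h0 : ∃ i < d, y 0 i ≠ 0) :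
    (∀ n, 0 < ∑ i ∈ Finset.range d, |y n i|) ∧
    ∃ l, Tendsto (fun n : ℕ => (n : ℝ)⁻¹ * Real.log (∑ i ∈ Finset.range d, |y n i|))
      atTop (𝓝 l) := by
  induction d generalizing y with
  | zero => simp at h0
  | succ d ih =>
    have hpos' : ∀ n, ∀ i < d, 0 < R n i i := fun n i hi => hpos n i (by omega)
    have hlam' := fun i (hi : i < d) => hlam i (by omega)
    have hyd : ∀ n, y (n + 1) d = R n d d * y n d := fun n => by
      rw [hy n d (by omega)]; simp
    by_cases hzero : y 0 d = 0
    · have hydz : ∀ n, y n d = 0 := fun n => by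
        induction n with
        | zero => exact hzero
        | succ n ihn => rw [hyd, ihn, mul_zero]
      have hsum : ∀ n, ∑ i ∈ Finset.range (d + 1), |y n i| = ∑ i ∈ Finset.range d, |y n i| :=
        fun n => by rw [Finset.sum_range_succ, hydz, abs_zero, add_zero]
      simp only [hsum]
      refine ih hpos' hlam' (fun n i hi => ?_) ?_
      · rw [hy n i (by omega), Finset.sum_Ico_succ_top hi.le, hydz, mul_zero, add_zero]
      · obtain ⟨i, hi, hi0⟩ := h0
        refine ⟨i, lt_of_le_of_ne (by omega) ?_, hi0⟩
        rintro rfl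
        exact hi0 hzero
    · set P : ℕ → ℝ := fun n => Real.exp (∑ k ∈ Finset.range n, Real.log (R k d d)) with hP
      have hydP : ∀ n, y n d = y 0 d * P n := fun n => by
        induction n with
        | zero => simp [hP]
        | succ n ihn =>
          rw [hyd, ihn]
          simp only [hP, Finset.sum_range_succ, Real.exp_add, Real.exp_log (hpos n d (by omega))]
          ring
      have hP0 : ∀ n, 0 < P n := fun n => Real.exp_pos _
      have hyd0 : ∀ n, 0 < |y n d| := fun n => by
        rw [abs_pos, hydP]; exact mul_ne_zero hzero (hP0 n).ne'
      have hPg : GrowthLE P (lam d) := growthLE_exp_of_tendsto (hlam d (by omega))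
      have hPi : GrowthLE (fun n => (P n)⁻¹) (-lam d) := by
        simpa [hP, Real.exp_neg] using growthLE_exp_neg_of_tendsto (hlam d (by omega))
      have hydg : GrowthLE (fun n => y n d) (lam d) := by
        rw [funext hydP]
        exact GrowthLE.bounded_mul (s := fun _ => y 0 d) (fun _ => le_rfl) hPg
      set N : ℕ → ℝ := fun n => ∑ i ∈ Finset.range (d + 1), |y n i| with hN
      have hNy : ∀ n, |y n d| ≤ N n := fun n =>
        Finset.single_le_sum (f := fun i => |y n i|) (fun _ _ => abs_nonneg _)
          (Finset.self_mem_range_succ d)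
      have hN0 : ∀ n, 0 < N n := fun n => (hyd0 n).trans_le (hNy n)
      have hNi : GrowthLE (fun n => (N n)⁻¹) (-lam d) := by
        refine hPi.trans_isBigO (Asymptotics.IsBigO.of_bound |y 0 d|⁻¹
          (Eventually.of_forall fun n => ?_))
        rw [Real.norm_eq_abs, Real.norm_eq_abs, abs_of_pos (inv_pos.2 (hN0 n)),
          abs_of_pos (inv_pos.2 (hP0 n)), ← mul_inv]
        refine inv_anti₀ (mul_pos (abs_pos.2 hzero) (hP0 n)) ((le_of_eq ?_).trans (hNy n))
        rw [hydP n, abs_mul, abs_of_pos (hP0 n)]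
      refine ⟨hN0, ?_⟩
      obtain ⟨z, hz, hzg⟩ := exists_triangular_solution (Λ := lam d) d hR hpos' hlam'
        (g := fun n i => R n i d * y n d)
        (fun i hi => GrowthLE.bounded_mul (fun n => hR n i d) hydg)
      have hdiff : ∀ n, ∀ i < d, y (n + 1) i - z (n + 1) i
          = ∑ k ∈ Finset.Ico i d, R n i k * (y n k - z n k) := fun n i hi => by
        rw [hy n i (by omega), hz n i hi, Finset.sum_Ico_succ_top hi.le]
        simp only [mul_sub, Finset.sum_sub_distrib]
        ring
      have hzsum : GrowthLE (fun n => ∑ i ∈ Finset.range d, |z n i|) (lam d) :=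
        GrowthLE.sum fun i hi => (hzg i (Finset.mem_range.1 hi)).abs
      have hNle : ∀ n, N n ≤ ∑ i ∈ Finset.range d, |y n i - z n i|
          + ∑ i ∈ Finset.range d, |z n i| + |y n d| := fun n => by
        simp only [hN, Finset.sum_range_succ, ← Finset.sum_add_distrib]
        gcongr with i hi
        calc |y n i| = |(y n i - z n i) + z n i| := by ring_nf
          _ ≤ _ := abs_add_le _ _
      have hupper : ∀ l, lam d ≤ l →
          GrowthLE (fun n => ∑ i ∈ Finset.range d, |y n i - z n i|) l → GrowthLE N l := by
        intro l hl hw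
        refine ((hw.add (hzsum.mono hl)).add (hydg.mono hl).abs).trans_isBigO
          (Asymptotics.IsBigO.of_bound 1 (Eventually.of_forall fun n => ?_))
        rw [one_mul, Real.norm_eq_abs, abs_of_pos (hN0 n)]
        exact (hNle n).trans (le_abs_self _)
      by_cases hw0 : ∃ i < d, y 0 i - z 0 i ≠ 0
      · obtain ⟨hw, l, hl⟩ := ih hpos' hlam' (y := fun n i => y n i - z n i) hdiff hw0
        have hwg := growthLE_of_tendsto_log hw hl
        have hwi := growthLE_inv_of_tendsto_log hw hl
        rcases le_or_gt l (lam d) with hle | hlt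
        · exact ⟨lam d, tendsto_log_of_growthLE hN0 (hupper _ le_rfl (hwg.mono hle)) hNi⟩
        · refine ⟨l, tendsto_log_of_growthLE hN0 (hupper _ hlt.le hwg) ?_⟩
          have hq := (hzsum.mul hwi).tendsto_zero (by linarith)
          -- As `l > lam d`, eventually `∑ |z| < (1/2) ∑ |w|`; with `∑ |w| ≤ N + ∑ |z|` this gives
          -- `∑ |w| ≤ 2 N`.
          refine hwi.trans_isBigO (Asymptotics.IsBigO.of_bound 2 ?_)
          filter_upwards [hq.eventually (gt_mem_nhds (show (0 : ℝ) < 1 / 2 by norm_num))]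
            with n hn
          rw [← div_eq_mul_inv, div_lt_iff₀ (hw n)] at hn
          have h3 : ∑ i ∈ Finset.range d, |y n i - z n i|
              ≤ N n + ∑ i ∈ Finset.range d, |z n i| := by
            have h4 : ∑ i ∈ Finset.range d, |y n i| ≤ N n := by
              simp only [hN, Finset.sum_range_succ]
              linarith [abs_nonneg (y n d)]
            have h5 : ∑ i ∈ Finset.range d, |y n i - z n i|
                ≤ ∑ i ∈ Finset.range d, |y n i| + ∑ i ∈ Finset.range d, |z n i| := by
              rw [← Finset.sum_add_distrib]
              exact Finset.sum_le_sum fun i _ => abs_sub _ _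
            linarith
          rw [Real.norm_eq_abs, Real.norm_eq_abs, abs_of_pos (inv_pos.2 (hN0 n)),
            abs_of_pos (inv_pos.2 (hw n)), inv_le_iff_one_le_mul₀ (hN0 n)]
          have hwn := hw n
          field_simp
          linarith
      · push Not at hw0
        have hwz : ∀ n, ∀ i < d, y n i - z n i = 0 := fun n => by
          induction n with
          | zero => exact hw0
          | succ n ihn =>
            intro i hi
            rw [hdiff n i hi]
            exact Finset.sum_eq_zero fun k hk => by
              rw [ihn k (Finset.mem_Ico.1 hk).2, mul_zero]
        refine ⟨lam d, tendsto_log_of_growthLE hN0 (hupper _ le_rfl ?_) hNi⟩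
        have : (fun n => ∑ i ∈ Finset.range d, |y n i - z n i|) = fun _ => 0 := by
          funext n
          exact Finset.sum_eq_zero fun i hi => by
            rw [hwz n i (Finset.mem_range.1 hi), abs_zero]
        rw [this]
        exact fun ε hε => Asymptotics.isBigO_zero _ _

end Triangular

/-! ### Almost-everywhere statements under image measures -/

/-- A property of `q y` that holds for almost every `y` holds almost everywhere for the image
measure, without any measurability assumption on the property. -/
theorem ae_map_of_ae_comp {Y X : Type*} [TopologicalSpace Y] [TopologicalSpace.MetrizableSpace Y]
    [CompactSpace Y] [MeasurableSpace Y] [BorelSpace Y] [TopologicalSpace X] [T2Space X]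
    [MeasurableSpace X] [BorelSpace X] {η : Measure Y} [IsFiniteMeasure η] (q : C(Y, X))
    {p : X → Prop} (h : ∀ᵐ y ∂η, p (q y)) : ∀ᵐ x ∂(η.map q), p x := by
  have hnull : η (toMeasurable η {y | ¬ p (q y)}) = 0 := by
    rw [measure_toMeasurable]; exact h
  set t := toMeasurable η {y | ¬ p (q y)} with ht
  have htm : MeasurableSet t := measurableSet_toMeasurable _ _
  refine nonpos_iff_eq_zero.1 (le_of_forall_gt fun ε hε => ?_)
  -- The image of a measurable set need not be measurable, but the image of a compact set is closed;
  -- inner regularity bridges the gap.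
  obtain ⟨K, hKs, hK, hKε⟩ := htm.compl.exists_isCompact_sdiff_lt (μ := η) (measure_ne_top _ _)
    hε.ne'
  have hqK : MeasurableSet (q '' K) := (hK.image q.continuous).isClosed.measurableSet
  calc (η.map q) {x | p x}ᶜ ≤ (η.map q) (q '' K)ᶜ := by
        refine measure_mono (compl_subset_compl.2 ?_)
        rintro _ ⟨y, hy, rfl⟩
        by_contra hp
        exact hKs hy (subset_toMeasurable η _ hp)
    _ = η (q ⁻¹' (q '' K)ᶜ) := Measure.map_apply q.continuous.measurable hqK.compl
    _ ≤ η (t ∪ (tᶜ \ K)) := by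
        refine measure_mono fun y hy => ?_
        by_cases hyt : y ∈ t
        · exact Or.inl hyt
        · exact Or.inr ⟨hyt, fun hyK => hy ⟨y, hyK, rfl⟩⟩
    _ ≤ η t + η (tᶜ \ K) := measure_union_le _ _
    _ < ε := by rwa [hnull, zero_add]

/-! ### Linear cocycles on bundles of subspaces -/

section Cocycle

variable {X H : Type*} [TopologicalSpace X] [NormedAddCommGroup H] [InnerProductSpace ℝ H]

/-- A continuous linear cocycle, injective on fibres, on the family `V` of subspaces of `H`
indexed by `X`. -/
structure BundleCocycle (V : X → Submodule ℝ H) where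
  /-- the map on the base -/
  base : C(X, X)
  /-- the linear map on the fibre over a point -/
  lin : X → H →ₗ[ℝ] H
  continuousOn_lin : ContinuousOn (fun p : X × H => lin p.1 p.2) {p | p.2 ∈ V p.1}
  lin_mem : ∀ x, ∀ z ∈ V x, lin x z ∈ V (base x)
  eq_zero_of_lin_eq_zero : ∀ x, ∀ z ∈ V x, lin x z = 0 → z = 0

namespace BundleCocycle

variable {V : X → Submodule ℝ H} (c : BundleCocycle V)

/-- The iterates of the cocycle. -/
def iter (x : X) (z : H) : ℕ → H
  | 0 => z
  | n + 1 => c.lin (c.base^[n] x) (iter x z n)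

theorem iter_mem {x : X} {z : H} (hz : z ∈ V x) (n : ℕ) : c.iter x z n ∈ V (c.base^[n] x) := by
  induction n with
  | zero => exact hz
  | succ n ih =>
    rw [Function.iterate_succ_apply']
    exact c.lin_mem _ _ ih

theorem iter_ne_zero {x : X} {z : H} (hz : z ∈ V x) (hz0 : z ≠ 0) (n : ℕ) : c.iter x z n ≠ 0 := by
  induction n with
  | zero => exact hz0
  | succ n ih => exact fun h => ih (c.eq_zero_of_lin_eq_zero _ _ (c.iter_mem hz n) h)

end BundleCocycle

/-! ### Orthonormal frames and the one-sided multiplicative ergodic theorem -/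

section Frames

/-- The space of orthonormal `d`-frames in the fibres of `V`. -/
def frameSet (V : X → Submodule ℝ H) (d : ℕ) : Set (X × (Fin d → H)) :=
  {p | (∀ i, p.2 i ∈ V p.1) ∧ Orthonormal ℝ p.2}

theorem isCompact_frameSet [CompactSpace X] [FiniteDimensional ℝ H] {V : X → Submodule ℝ H}
    (hV : IsClosed {p : X × H | p.2 ∈ V p.1}) (d : ℕ) : IsCompact (frameSet V d) := by
  have hc : IsCompact ((univ : Set X) ×ˢ Set.pi univ fun _ : Fin d => Metric.closedBall (0 : H) 1) :=
    isCompact_univ.prod (isCompact_univ_pi fun _ => isCompact_closedBall _ _)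
  refine hc.of_isClosed_subset ?_ ?_
  · have h1 : IsClosed {p : X × (Fin d → H) | ∀ i, p.2 i ∈ V p.1} := by
      simp only [ofPred_forall]
      refine isClosed_iInter fun i => ?_
      exact hV.preimage (f := fun p : X × (Fin d → H) => (p.1, p.2 i)) (by fun_prop)
    have h2 : IsClosed {p : X × (Fin d → H) | Orthonormal ℝ p.2} := by
      simp only [orthonormal_iff_ite, ofPred_forall]
      refine isClosed_iInter fun i => isClosed_iInter fun j => ?_
      exact isClosed_eq (by fun_prop) continuous_const
    exact h1.inter h2
  · rintro ⟨x, w⟩ ⟨-, hw⟩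
    refine ⟨mem_univ _, fun i _ => ?_⟩
    simp [hw.1 i]

/-- Linear independence keeps the denominators `‖gramSchmidt j‖ ^ 2` away from zero at each step of
the recursion. -/
theorem continuous_gramSchmidt {Y : Type*} [TopologicalSpace Y] {d : ℕ} {f : Y → Fin d → H}
    (hf : Continuous f) (hli : ∀ y, LinearIndependent ℝ (f y)) (i : Fin d) :
    Continuous fun y => InnerProductSpace.gramSchmidt ℝ (f y) i := by
  induction i using WellFoundedLT.induction with
  | ind i ih =>
    simp only [InnerProductSpace.gramSchmidt_def ℝ _ i, Submodule.starProjection_singleton]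
    refine ((continuous_apply i).comp hf).sub (continuous_finsetSum _ fun j hj => ?_)
    have hj' := ih j (Finset.mem_Iio.1 hj)
    refine Continuous.smul (Continuous.div (hj'.inner ((continuous_apply i).comp hf)) ?_ ?_) hj'
    · exact_mod_cast hj'.norm.pow 2
    · intro y
      have := InnerProductSpace.gramSchmidt_ne_zero j (hli y)
      simpa using this

theorem eq_sum_inner_smul {d : ℕ} {w : Fin d → H} (hw : Orthonormal ℝ w) {z : H}
    (hz : z ∈ Submodule.span ℝ (range w)) : z = ∑ i, inner ℝ (w i) z • w i := by
  obtain ⟨a, rfl⟩ := (Submodule.mem_span_range_iff_exists_fun ℝ).1 hz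
  simp only [hw.inner_right_fintype]

variable {V : X → Submodule ℝ H} {d : ℕ}

theorem span_frame {X : Type*} {V : X → Submodule ℝ H} [FiniteDimensional ℝ H]
    (hd : ∀ x, Module.finrank ℝ (V x) = d)
    {p : X × (Fin d → H)} (hp : p ∈ frameSet V d) : Submodule.span ℝ (range p.2) = V p.1 := by
  refine Submodule.eq_of_le_of_finrank_eq ?_ ?_
  · rw [Submodule.span_le]
    rintro _ ⟨i, rfl⟩
    exact hp.1 i
  · rw [finrank_span_eq_card hp.2.linearIndependent, hd, Fintype.card_fin]

namespace BundleCocycle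

variable (c : BundleCocycle V)

theorem linearIndependent_lin_frame {p : X × (Fin d → H)} (hp : p ∈ frameSet V d) :
    LinearIndependent ℝ fun i => c.lin p.1 (p.2 i) := by
  refine hp.2.linearIndependent.map_injOn (c.lin p.1) ?_
  have hle : Submodule.span ℝ (range p.2) ≤ V p.1 := by
    rw [Submodule.span_le]
    rintro _ ⟨i, rfl⟩
    exact hp.1 i
  intro a ha b hb hab
  refine sub_eq_zero.1 (c.eq_zero_of_lin_eq_zero p.1 _ ((V p.1).sub_mem (hle ha) (hle hb)) ?_)
  rw [map_sub, hab, sub_self]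

theorem continuous_lin_frame :
    Continuous fun (p : frameSet V d) (i : Fin d) => c.lin p.1.1 (p.1.2 i) := by
  refine continuous_pi fun i => ?_
  have h : Continuous fun p : frameSet V d => (p.1.1, p.1.2 i) := by fun_prop
  exact c.continuousOn_lin.comp_continuous h fun p => p.2.1 i

theorem gramSchmidtNormed_mem_frameSet (p : frameSet V d) :
    (c.base p.1.1, InnerProductSpace.gramSchmidtNormed ℝ fun i => c.lin p.1.1 (p.1.2 i))
      ∈ frameSet V d := by
  refine ⟨fun i => ?_, InnerProductSpace.gramSchmidtNormed_orthonormal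
    (c.linearIndependent_lin_frame p.2)⟩
  have h1 : InnerProductSpace.gramSchmidtNormed ℝ (fun i => c.lin p.1.1 (p.1.2 i)) i
      ∈ Submodule.span ℝ (range (InnerProductSpace.gramSchmidtNormed ℝ
        fun i => c.lin p.1.1 (p.1.2 i))) := Submodule.subset_span ⟨i, rfl⟩
  rw [InnerProductSpace.span_gramSchmidtNormed_range, InnerProductSpace.span_gramSchmidt] at h1
  refine Submodule.span_le.2 ?_ h1
  rintro _ ⟨j, rfl⟩
  exact c.lin_mem _ _ (p.2.1 j)

/-- The action of the cocycle on orthonormal frames. -/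
noncomputable def frameMap : C(frameSet V d, frameSet V d) where
  toFun p := ⟨_, c.gramSchmidtNormed_mem_frameSet p⟩
  continuous_toFun := by
    refine Continuous.subtype_mk (Continuous.prodMk
      (c.base.continuous.comp (continuous_fst.comp continuous_subtype_val))
      (continuous_pi fun i => ?_)) _
    have h := continuous_gramSchmidt c.continuous_lin_frame
      (fun p : frameSet V d => c.linearIndependent_lin_frame p.2) i
    refine Continuous.smul (Continuous.inv₀ ?_ fun p => ?_) h
    · exact_mod_cast h.norm
    · have := InnerProductSpace.gramSchmidt_ne_zero i (c.linearIndependent_lin_frame p.2)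
      simpa using this

/-- The logarithm of the `i`-th diagonal entry of the matrix of the cocycle in moving frames. -/
noncomputable def logDiag (i : Fin d) : C(frameSet V d, ℝ) where
  toFun p := Real.log ‖InnerProductSpace.gramSchmidt ℝ (fun i => c.lin p.1.1 (p.1.2 i)) i‖
  continuous_toFun := by
    refine Continuous.log (continuous_gramSchmidt c.continuous_lin_frame
      (fun p : frameSet V d => c.linearIndependent_lin_frame p.2) i).norm fun p => ?_
    exact norm_ne_zero_iff.2
      (InnerProductSpace.gramSchmidt_ne_zero i (c.linearIndependent_lin_frame p.2))

/-- The matrix of the cocycle in moving frames. -/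
noncomputable def frameMatrix (p : frameSet V d) (i k : Fin d) : ℝ :=
  inner ℝ ((c.frameMap p).1.2 i) (c.lin p.1.1 (p.1.2 k))

/-- This is the QR decomposition: the `i`-th new frame vector is orthogonal to the images of all
earlier ones. -/
theorem frameMatrix_of_lt (p : frameSet V d) {i k : Fin d} (h : k < i) :
    c.frameMatrix p i k = 0 := by
  have := InnerProductSpace.gramSchmidt_inv_triangular ℝ (fun i => c.lin p.1.1 (p.1.2 i)) h
  simp only [frameMatrix, frameMap, ContinuousMap.coe_mk, InnerProductSpace.gramSchmidtNormed,
    inner_smul_left, this, mul_zero]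

/-- The image of the `i`-th vector differs from its Gram–Schmidt vector by earlier ones, orthogonal
to it. Hence the diagonal is positive and `logDiag` is its logarithm. -/
theorem frameMatrix_self (p : frameSet V d) (i : Fin d) :
    c.frameMatrix p i i =
      ‖InnerProductSpace.gramSchmidt ℝ (fun i => c.lin p.1.1 (p.1.2 i)) i‖ := by
  set f : Fin d → H := fun i => c.lin p.1.1 (p.1.2 i) with hf
  have h0 : ‖InnerProductSpace.gramSchmidt ℝ f i‖ ≠ 0 := norm_ne_zero_iff.2
    (InnerProductSpace.gramSchmidt_ne_zero i (c.linearIndependent_lin_frame p.2))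
  have h1 : inner ℝ (InnerProductSpace.gramSchmidt ℝ f i) (f i)
      = ‖InnerProductSpace.gramSchmidt ℝ f i‖ ^ 2 := by
    conv_lhs => rw [InnerProductSpace.gramSchmidt_def'' ℝ f i]
    rw [inner_add_right, inner_sum, real_inner_self_eq_norm_sq, Finset.sum_eq_zero, add_zero]
    intro j hj
    rw [inner_smul_right, InnerProductSpace.gramSchmidt_orthogonal ℝ f
      (Finset.mem_Iio.1 hj).ne', mul_zero]
  change inner ℝ (InnerProductSpace.gramSchmidtNormed ℝ f i) (f i) = _
  rw [InnerProductSpace.gramSchmidtNormed, inner_smul_left, h1]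
  simp
  field_simp

theorem abs_frameMatrix_le [CompactSpace (frameSet V d)] :
    ∃ B, ∀ (p : frameSet V d) i k, |c.frameMatrix p i k| ≤ B := by
  let φ : C(frameSet V d, Fin d → H) := ⟨_, c.continuous_lin_frame⟩
  refine ⟨‖φ‖, fun p i k => ?_⟩
  refine (abs_real_inner_le_norm _ _).trans ?_
  rw [(c.frameMap p).2.2.1 i, one_mul]
  exact (norm_le_pi_norm (φ p) k).trans (φ.norm_coe_le_norm p)

theorem frameMap_iterate_fst (p : frameSet V d) (n : ℕ) :
    (c.frameMap^[n] p).1.1 = c.base^[n] p.1.1 :=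
  Function.Semiconj.iterate_right (f := fun p : frameSet V d => p.1.1) (ga := c.frameMap)
    (gb := c.base) (fun _ => rfl) n p

/-- If the diagonal entries of the cocycle along the orbit of a frame have exact exponents, so do
all vectors in the fibre. -/
theorem exists_tendsto_log_iter_of_frame [FiniteDimensional ℝ H]
    [CompactSpace (frameSet V d)] (hd : ∀ x, Module.finrank ℝ (V x) = d) (p : frameSet V d)
    (hp : ∀ i, ∃ l, Tendsto (fun n => birkhoffAverage ℝ c.frameMap (c.logDiag i) n p)
      atTop (𝓝 l)) {z : H} (hz : z ∈ V p.1.1) (hz0 : z ≠ 0) :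
    ∃ l, Tendsto (fun n : ℕ => (n : ℝ)⁻¹ * Real.log ‖c.iter p.1.1 z n‖) atTop (𝓝 l) := by
  choose lam hlam using hp
  obtain ⟨B, hB⟩ := c.abs_frameMatrix_le (d := d)
  set w : ℕ → frameSet V d := fun n => c.frameMap^[n] p with hw
  have hws : ∀ n, w (n + 1) = c.frameMap (w n) := fun n => Function.iterate_succ_apply' _ _ _
  have hwb : ∀ n, (w n).1.1 = c.base^[n] p.1.1 := c.frameMap_iterate_fst p
  set v : ℕ → H := c.iter p.1.1 z with hv
  have hvm : ∀ n, v n ∈ Submodule.span ℝ (range (w n).1.2) := fun n => by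
    rw [span_frame hd (w n).2, hwb]
    exact c.iter_mem hz n
  have hv0 : ∀ n, 0 < ‖v n‖ := fun n => norm_pos_iff.2 (c.iter_ne_zero hz hz0 n)
  have hve : ∀ n, v n = ∑ i, inner ℝ ((w n).1.2 i) (v n) • (w n).1.2 i := fun n =>
    eq_sum_inner_smul (w n).2.2 (hvm n)
  -- Matrix and coordinates are extended by zero from `Fin d` to `ℕ`, the form in which the
  -- triangular recurrence was solved by induction on `d`.
  let R : ℕ → ℕ → ℕ → ℝ := fun n i k =>
    if h : i < d ∧ k < d then c.frameMatrix (w n) ⟨i, h.1⟩ ⟨k, h.2⟩ else 0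
  let y : ℕ → ℕ → ℝ := fun n i => if h : i < d then inner ℝ ((w n).1.2 ⟨i, h⟩) (v n) else 0
  have hRf : ∀ n (i k : Fin d), R n i k = c.frameMatrix (w n) i k := fun n i k => by
    simp [R]
  have hyf : ∀ n (i : Fin d), y n i = inner ℝ ((w n).1.2 i) (v n) := fun n i => by simp [y]
  have hRb : ∀ n i k, |R n i k| ≤ |B| := fun n i k => by
    simp only [R]
    split_ifs with h
    · exact (hB _ _ _).trans (le_abs_self B)
    · simp
  have hRpos : ∀ n, ∀ i < d, 0 < R n i i := fun n i hi => by
    rw [show R n i i = _ from hRf n ⟨i, hi⟩ ⟨i, hi⟩, frameMatrix_self]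
    exact norm_pos_iff.2
      (InnerProductSpace.gramSchmidt_ne_zero _ (c.linearIndependent_lin_frame (w n).2))
  have hlam' : ∀ i < d, Tendsto (fun n : ℕ => (n : ℝ)⁻¹ *
      ∑ k ∈ Finset.range n, Real.log (R k i i)) atTop
      (𝓝 ((fun i : ℕ => if h : i < d then lam ⟨i, h⟩ else 0) i)) := fun i hi => by
    simp only [hi, dif_pos]
    refine (hlam ⟨i, hi⟩).congr fun n => ?_
    simp only [birkhoffAverage, birkhoffSum, smul_eq_mul]
    congr 1
    refine Finset.sum_congr rfl fun k _ => ?_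
    rw [show R k i i = _ from hRf k ⟨i, hi⟩ ⟨i, hi⟩, frameMatrix_self]
    rfl
  have hrec : ∀ n, ∀ i < d, y (n + 1) i = ∑ k ∈ Finset.Ico i d, R n i k * y n k := by
    intro n i hi
    have h1 : v (n + 1) = ∑ k, inner ℝ ((w n).1.2 k) (v n) • c.lin (w n).1.1 ((w n).1.2 k) := by
      have h2 : v (n + 1) = c.lin (w n).1.1 (v n) := by rw [hwb]; rfl
      rw [h2]
      conv_lhs => rw [hve n]
      simp only [map_sum, map_smul]
    have h3 : y (n + 1) i = ∑ k : Fin d, R n i k * y n k := by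
      rw [show y (n + 1) i = _ from hyf (n + 1) ⟨i, hi⟩, h1, inner_sum]
      refine Finset.sum_congr rfl fun k _ => ?_
      rw [show R n i k = _ from hRf n ⟨i, hi⟩ k, hyf, inner_smul_right, mul_comm, frameMatrix, hws]
    rw [h3, Fin.sum_univ_eq_sum_range (fun k => R n i k * y n k), Finset.range_eq_Ico]
    refine (Finset.sum_subset (Finset.Ico_subset_Ico_left (Nat.zero_le i)) fun k hk hk' => ?_).symm
    simp only [Finset.mem_Ico, not_and, not_lt] at hk hk'
    have hki : k < i := by
      by_contra hcon
      exact absurd hk.2 (not_lt.2 (hk' (not_lt.1 hcon)))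
    rw [show R n i k = _ from hRf n ⟨i, hi⟩ ⟨k, hk.2⟩, c.frameMatrix_of_lt (w n) hki, zero_mul]
  have hy0 : ∃ i < d, y 0 i ≠ 0 := by
    by_contra hcon
    push Not at hcon
    refine hz0 ?_
    have : z = ∑ i, inner ℝ ((w 0).1.2 i) (v 0) • (w 0).1.2 i := hve 0
    rw [this]
    refine Finset.sum_eq_zero fun i _ => ?_
    rw [← hyf, hcon i i.2, zero_smul]
  obtain ⟨hpos, l, hl⟩ := tendsto_log_triangular_solution d hRb hRpos hlam' hrec hy0
  -- The frames are orthonormal, so the `ℓ¹` norm of the coordinates and `‖v n‖` are comparable with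
  -- constants independent of `n`.
  refine ⟨l, tendsto_log_of_isTheta hpos hv0 ?_ ?_ hl⟩
  · refine Asymptotics.IsBigO.of_bound d (Eventually.of_forall fun n => ?_)
    rw [Real.norm_eq_abs, abs_of_pos (hpos n), norm_norm]
    calc ∑ i ∈ Finset.range d, |y n i| ≤ ∑ i ∈ Finset.range d, ‖v n‖ := by
          refine Finset.sum_le_sum fun i hi => ?_
          have hi' := Finset.mem_range.1 hi
          rw [show y n i = _ from hyf n ⟨i, hi'⟩]
          refine (abs_real_inner_le_norm _ _).trans ?_
          rw [(w n).2.2.1, one_mul]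
      _ = d * ‖v n‖ := by simp
  · refine Asymptotics.IsBigO.of_bound 1 (Eventually.of_forall fun n => ?_)
    rw [Real.norm_eq_abs, Real.norm_eq_abs, abs_of_pos (hpos n), abs_of_pos (hv0 n), one_mul]
    conv_lhs => rw [hve n]
    refine (norm_sum_le _ _).trans ?_
    rw [← Fin.sum_univ_eq_sum_range (fun i => |y n i|)]
    refine Finset.sum_le_sum fun i _ => ?_
    rw [norm_smul, (w n).2.2.1, mul_one, hyf]
    rfl

/-- One-sided multiplicative ergodic theorem: at almost every point, all nonzero vectors of the
fibre have exact exponents. -/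
theorem ae_exists_tendsto_log_iter [CompactSpace X] [TopologicalSpace.MetrizableSpace X]
    [MeasurableSpace X] [BorelSpace X] [FiniteDimensional ℝ H]
    (hV : IsClosed {p : X × H | p.2 ∈ V p.1}) (hd : ∀ x, Module.finrank ℝ (V x) = d)
    {μ : Measure X} [IsProbabilityMeasure μ] (hμ : Ergodic c.base μ) :
    ∀ᵐ x ∂μ, ∀ z ∈ V x, z ≠ 0 →
      ∃ l, Tendsto (fun n : ℕ => (n : ℝ)⁻¹ * Real.log ‖c.iter x z n‖) atTop (𝓝 l) := by
  have : CompactSpace (frameSet V d) := isCompact_iff_compactSpace.1 (isCompact_frameSet hV d)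
  let _ : MeasurableSpace (frameSet V d) := borel _
  have : BorelSpace (frameSet V d) := ⟨rfl⟩
  obtain ⟨x₀, hx₀⟩ := (ae_isTypicalPoint hμ).exists
  -- Any frame over a typical point will do: its orbit yields an invariant measure on frames that
  -- projects to `μ`.
  let b := (stdOrthonormalBasis ℝ (V x₀)).reindex (finCongr (hd x₀))
  let p₀ : frameSet V d := ⟨(x₀, fun i => (b i : H)), fun i => (b i).2,
    b.orthonormal.comp_linearIsometry (V x₀).subtypeₗᵢ⟩
  let q : C(frameSet V d, X) := ⟨fun p => p.1.1, by fun_prop⟩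
  obtain ⟨η, hη, hq, -⟩ := exists_invariant_lift (S := c.frameMap) (T := c.base) (q := q)
    (fun _ => rfl) (y₀ := p₀) hx₀
  have h : ∀ᵐ p ∂(η : Measure (frameSet V d)), ∀ i, ∃ l,
      Tendsto (fun n => birkhoffAverage ℝ c.frameMap (c.logDiag i) n p) atTop (𝓝 l) := by
    refine ae_all_iff.2 fun i => ?_
    exact ae_exists_tendsto_birkhoffAverage hη (c.logDiag i).continuous.measurable
      (fun p => (c.logDiag i).norm_coe_le_norm p)
  rw [← hq]
  -- The conclusion depends on a frame only through its base point, so it descends from `η` to `μ`.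
  refine ae_map_of_ae_comp q ?_
  filter_upwards [h] with p hp z hz hz0
  exact c.exists_tendsto_log_iter_of_frame hd p hp hz hz0

end BundleCocycle

end Frames

end Cocycle

/-! ### The unit sphere bundle and limits of non-expanding measures -/

section Sphere

variable {X H : Type*} [TopologicalSpace X] [NormedAddCommGroup H] [InnerProductSpace ℝ H]

/-- The unit sphere bundle of `V`. -/
def sphereSet (V : X → Submodule ℝ H) : Set (X × H) := {p | p.2 ∈ V p.1 ∧ ‖p.2‖ = 1}

theorem isCompact_sphereSet [CompactSpace X] [FiniteDimensional ℝ H] {V : X → Submodule ℝ H}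
    (hV : IsClosed {p : X × H | p.2 ∈ V p.1}) : IsCompact (sphereSet V) := by
  have hc : IsCompact ((univ : Set X) ×ˢ Metric.closedBall (0 : H) 1) :=
    isCompact_univ.prod (isCompact_closedBall _ _)
  refine hc.of_isClosed_subset ?_ ?_
  · exact hV.inter (isClosed_eq (by fun_prop) continuous_const)
  · rintro ⟨x, z⟩ ⟨-, hz⟩
    exact ⟨mem_univ _, by simp [show ‖z‖ = 1 from hz]⟩

variable {V : X → Submodule ℝ H}

namespace BundleCocycle

theorem lin_ne_zero (c : BundleCocycle V) (p : sphereSet V) : c.lin p.1.1 p.1.2 ≠ 0 := by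
  intro h
  have h1 := c.eq_zero_of_lin_eq_zero _ _ p.2.1 h
  have h2 := p.2.2
  rw [h1] at h2
  simp at h2

theorem normalize_mem_sphereSet (c : BundleCocycle V) (p : sphereSet V) :
    (c.base p.1.1, ‖c.lin p.1.1 p.1.2‖⁻¹ • c.lin p.1.1 p.1.2) ∈ sphereSet V := by
  refine ⟨(V _).smul_mem _ (c.lin_mem _ _ p.2.1), ?_⟩
  rw [norm_smul, norm_inv, norm_norm,
    inv_mul_cancel₀ (norm_ne_zero_iff.2 (c.lin_ne_zero p))]

theorem continuous_lin_sphere (c : BundleCocycle V) :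
    Continuous fun p : sphereSet V => c.lin p.1.1 p.1.2 :=
  c.continuousOn_lin.comp_continuous continuous_subtype_val fun p => p.2.1

/-- The action of the cocycle on the unit sphere bundle. -/
noncomputable def sphereMap (c : BundleCocycle V) : C(sphereSet V, sphereSet V) where
  toFun p := ⟨_, c.normalize_mem_sphereSet p⟩
  continuous_toFun := by
    refine Continuous.subtype_mk (Continuous.prodMk
      (c.base.continuous.comp (continuous_fst.comp continuous_subtype_val)) ?_) _
    exact (c.continuous_lin_sphere.norm.inv₀ fun p =>
      norm_ne_zero_iff.2 (c.lin_ne_zero p)).smul c.continuous_lin_sphere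

/-- The logarithmic expansion rate on the unit sphere bundle. -/
noncomputable def logNorm (c : BundleCocycle V) : C(sphereSet V, ℝ) where
  toFun p := Real.log ‖c.lin p.1.1 p.1.2‖
  continuous_toFun := c.continuous_lin_sphere.norm.log fun p =>
    norm_ne_zero_iff.2 (c.lin_ne_zero p)

/-- Currying turns joint continuity into continuity for the compact-open topology, that is, uniform
dependence on the parameter when the sphere bundle is compact. -/
theorem continuous_sphereMap_of_param {P : Type*} [TopologicalSpace P] {c : P → BundleCocycle V}
    (hbase : Continuous fun a : P × sphereSet V => (c a.1).base a.2.1.1)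
    (hlin : Continuous fun a : P × sphereSet V => (c a.1).lin a.2.1.1 a.2.1.2) :
    Continuous fun k => (c k).sphereMap :=
  ContinuousMap.continuous_of_continuous_uncurry _ (Continuous.subtype_mk
    (Continuous.prodMk hbase ((hlin.norm.inv₀ fun a =>
      norm_ne_zero_iff.2 ((c a.1).lin_ne_zero a.2)).smul hlin)) _)

theorem continuous_logNorm_of_param {P : Type*} [TopologicalSpace P] {c : P → BundleCocycle V}
    (hlin : Continuous fun a : P × sphereSet V => (c a.1).lin a.2.1.1 a.2.1.2) :
    Continuous fun k => (c k).logNorm :=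
  ContinuousMap.continuous_of_continuous_uncurry _
    (hlin.norm.log fun a => norm_ne_zero_iff.2 ((c a.1).lin_ne_zero a.2))

theorem sphereMap_iterate (c : BundleCocycle V) (p : sphereSet V) (n : ℕ) :
    (c.sphereMap^[n] p).1 =
      (c.base^[n] p.1.1, ‖c.iter p.1.1 p.1.2 n‖⁻¹ • c.iter p.1.1 p.1.2 n) := by
  induction n with
  | zero => simp [iter, p.2.2]
  | succ n ih =>
    have h0 : ‖c.iter p.1.1 p.1.2 n‖ ≠ 0 := norm_ne_zero_iff.2 (c.iter_ne_zero p.2.1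
      (norm_ne_zero_iff.1 (by rw [p.2.2]; exact one_ne_zero)) n)
    rw [Function.iterate_succ_apply', Function.iterate_succ_apply']
    change (c.base (c.sphereMap^[n] p).1.1, ‖c.lin (c.sphereMap^[n] p).1.1
      (c.sphereMap^[n] p).1.2‖⁻¹ • c.lin (c.sphereMap^[n] p).1.1 (c.sphereMap^[n] p).1.2) = _
    rw [ih]
    simp only [map_smul, norm_smul, norm_inv, norm_norm, iter, Prod.mk.injEq, true_and, smul_smul]
    congr 1
    field_simp

/-- The logarithms of the normalizing factors telescope. Lyapunov exponents thereby become limits of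
Birkhoff averages. -/
theorem birkhoffSum_logNorm (c : BundleCocycle V) (p : sphereSet V) (n : ℕ) :
    birkhoffSum c.sphereMap c.logNorm n p = Real.log ‖c.iter p.1.1 p.1.2 n‖ := by
  have h0 : ∀ n, ‖c.iter p.1.1 p.1.2 n‖ ≠ 0 := fun n => norm_ne_zero_iff.2
    (c.iter_ne_zero p.2.1 (norm_ne_zero_iff.1 (by rw [p.2.2]; exact one_ne_zero)) n)
  induction n with
  | zero => simp [iter, p.2.2]
  | succ n ih =>
    rw [birkhoffSum_succ, ih]
    change _ + Real.log ‖c.lin (c.sphereMap^[n] p).1.1 (c.sphereMap^[n] p).1.2‖ = _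
    rw [c.sphereMap_iterate p n]
    simp only [map_smul, norm_smul, norm_inv, norm_norm]
    have h1 := h0 (n + 1)
    simp only [iter] at h1 ⊢
    rw [Real.log_mul (inv_ne_zero (h0 n)) h1, Real.log_inv]
    ring

/-- A measure is expanding if almost everywhere all nonzero vectors have a positive exponent. -/
def Expanding [MeasurableSpace X] (c : BundleCocycle V) (μ : Measure X) : Prop :=
  ∀ᵐ x ∂μ, ∀ z ∈ V x, z ≠ 0 → ∃ l, 0 < l ∧
    Tendsto (fun n : ℕ => (n : ℝ)⁻¹ * Real.log ‖c.iter x z n‖) atTop (𝓝 l)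

theorem iter_smul (c : BundleCocycle V) (x : X) (a : ℝ) (z : H) (n : ℕ) :
    c.iter x (a • z) n = a • c.iter x z n := by
  induction n with
  | zero => rfl
  | succ n ih => simp only [iter, ih, map_smul]

theorem tendsto_log_iter_smul (c : BundleCocycle V) {x : X} {z : H} (hz : z ∈ V x) (hz0 : z ≠ 0)
    {a : ℝ} (ha : a ≠ 0) {l : ℝ}
    (h : Tendsto (fun n : ℕ => (n : ℝ)⁻¹ * Real.log ‖c.iter x z n‖) atTop (𝓝 l)) :
    Tendsto (fun n : ℕ => (n : ℝ)⁻¹ * Real.log ‖c.iter x (a • z) n‖) atTop (𝓝 l) := by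
  have h1 : Tendsto (fun n : ℕ => (n : ℝ)⁻¹ * Real.log ‖a‖) atTop (𝓝 0) := by
    simpa using tendsto_inv_atTop_nhds_zero_nat.mul_const (Real.log ‖a‖)
  have h2 := h1.add h
  rw [zero_add] at h2
  refine h2.congr fun n => ?_
  rw [iter_smul, norm_smul, Real.log_mul (norm_ne_zero_iff.2 ha)
    (norm_ne_zero_iff.2 (c.iter_ne_zero hz hz0 n)), mul_add]

variable [MeasurableSpace X] [BorelSpace X] [CompactSpace (sphereSet V)]
  [MeasurableSpace (sphereSet V)] [BorelSpace (sphereSet V)]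

/-- Expansion makes the averages of `logNorm` converge almost everywhere to a positive limit;
invariance and dominated convergence give that limit the integral of `logNorm`. Ergodicity plays no
role, which matters because weak* limits of ergodic measures need not be ergodic. -/
theorem integral_logNorm_pos (c : BundleCocycle V) {η : ProbabilityMeasure (sphereSet V)}
    (hη : MeasurePreserving c.sphereMap (η : Measure (sphereSet V)) (η : Measure (sphereSet V)))
    (hexp : c.Expanding ((η : Measure (sphereSet V)).map fun p => p.1.1)) :
    0 < ∫ p, c.logNorm p ∂(η : Measure (sphereSet V)) := by
  have hm : Measurable fun p : sphereSet V => p.1.1 :=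
    (show Continuous fun p : sphereSet V => p.1.1 by fun_prop).measurable
  have h1 : ∀ᵐ p ∂(η : Measure (sphereSet V)), ∃ l, 0 < l ∧
      Tendsto (fun n => birkhoffAverage ℝ c.sphereMap c.logNorm n p) atTop (𝓝 l) := by
    filter_upwards [ae_of_ae_map hm.aemeasurable hexp] with p hp
    obtain ⟨l, hl0, hl⟩ := hp p.1.2 p.2.1
      (norm_ne_zero_iff.1 (by rw [p.2.2]; exact one_ne_zero))
    refine ⟨l, hl0, hl.congr fun n => ?_⟩
    rw [birkhoffAverage, birkhoffSum_logNorm, smul_eq_mul]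
  set g : sphereSet V → ℝ := fun p =>
    limUnder atTop fun n => birkhoffAverage ℝ c.sphereMap c.logNorm n p with hg
  have h2 : ∀ᵐ p ∂(η : Measure (sphereSet V)),
      Tendsto (fun n => birkhoffAverage ℝ c.sphereMap c.logNorm n p) atTop (𝓝 (g p)) := by
    filter_upwards [h1] with p ⟨l, _, hl⟩ using tendsto_nhds_limUnder ⟨l, hl⟩
  have h3 : ∀ᵐ p ∂(η : Measure (sphereSet V)), 0 < g p := by
    filter_upwards [h1, h2] with p ⟨l, hl0, hl⟩ hp
    rwa [tendsto_nhds_unique hp hl]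
  have hmeas := c.logNorm.continuous.measurable
  have hbd : ∀ p, |c.logNorm p| ≤ ‖c.logNorm‖ := fun p => c.logNorm.norm_coe_le_norm p
  have hgm : AEStronglyMeasurable g (η : Measure (sphereSet V)) :=
    aestronglyMeasurable_of_tendsto_ae atTop
      (fun n => (measurable_birkhoffAverage hη.measurable hmeas n).aestronglyMeasurable) h2
  have hgb : ∀ᵐ p ∂(η : Measure (sphereSet V)), ‖g p‖ ≤ ‖c.logNorm‖ := by
    filter_upwards [h2] with p hp
    exact le_of_tendsto' hp.norm fun n => abs_birkhoffAverage_le hbd n p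
  have hgi : Integrable g (η : Measure (sphereSet V)) := Integrable.of_bound hgm _ hgb
  have hlim : Tendsto (fun n => ∫ p, birkhoffAverage ℝ c.sphereMap c.logNorm n p
      ∂(η : Measure (sphereSet V))) atTop (𝓝 (∫ p, g p ∂(η : Measure (sphereSet V)))) :=
    tendsto_integral_of_dominated_convergence (fun _ => ‖c.logNorm‖)
      (fun n => (measurable_birkhoffAverage hη.measurable hmeas n).aestronglyMeasurable)
      (integrable_const _) (fun n => ae_of_all _ fun p => abs_birkhoffAverage_le hbd n p) h2
  have hconst : Tendsto (fun n => ∫ p, birkhoffAverage ℝ c.sphereMap c.logNorm n p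
      ∂(η : Measure (sphereSet V))) atTop
      (𝓝 (∫ p, c.logNorm p ∂(η : Measure (sphereSet V)))) := by
    refine tendsto_const_nhds.congr' ?_
    filter_upwards [eventually_ne_atTop 0] with n hn
      using (integral_birkhoffAverage hη hmeas hbd hn).symm
  rw [← tendsto_nhds_unique hlim hconst]
  refine (integral_pos_iff_support_of_nonneg_ae (h3.mono fun _ h => h.le) hgi).2 ?_
  have : Function.support g =ᵐ[(η : Measure (sphereSet V))] univ :=
    eventuallyEq_univ.2 (h3.mono fun p hp => hp.ne')
  rw [measure_congr this]
  simp

variable [CompactSpace X] [TopologicalSpace.MetrizableSpace X] [FiniteDimensional ℝ H]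

/-- Points violating expansion do not form a null set, so one of them is typical and has all its
exponents. A vector there with exponent `≤ 0` generates the lift. -/
theorem exists_lift_integral_logNorm_nonpos {d : ℕ} (c : BundleCocycle V)
    (hV : IsClosed {p : X × H | p.2 ∈ V p.1}) (hd : ∀ x, Module.finrank ℝ (V x) = d)
    {μ : Measure X} [IsProbabilityMeasure μ] (hμ : Ergodic c.base μ) (hexp : ¬ c.Expanding μ) :
    ∃ η : ProbabilityMeasure (sphereSet V),
      MeasurePreserving c.sphereMap (η : Measure (sphereSet V)) (η : Measure (sphereSet V)) ∧
      (η : Measure (sphereSet V)).map (fun p => p.1.1) = μ ∧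
      ∫ p, c.logNorm p ∂(η : Measure (sphereSet V)) ≤ 0 := by
  have h1 := c.ae_exists_tendsto_log_iter hV hd hμ
  have h2 := ae_isTypicalPoint hμ
  obtain ⟨x, hx, hxe, hxt⟩ := ((not_eventually.1 hexp).and_eventually (h1.and h2)).exists
  push Not at hx
  obtain ⟨z, hz, hz0, hzl⟩ := hx
  obtain ⟨l, hl⟩ := hxe z hz hz0
  -- Since the limit exists, the failure can only lie in its sign.
  have hl0 : l ≤ 0 := not_lt.1 fun hpos => hzl l hpos hl
  have hz0' : ‖z‖ ≠ 0 := norm_ne_zero_iff.2 hz0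
  let p₀ : sphereSet V := ⟨(x, ‖z‖⁻¹ • z), (V x).smul_mem _ hz, by
    simp [norm_smul, hz0']⟩
  let q : C(sphereSet V, X) := ⟨fun p => p.1.1, by fun_prop⟩
  obtain ⟨η, hη, hq, hint⟩ := exists_invariant_lift (S := c.sphereMap) (T := c.base) (q := q)
    (fun _ => rfl) (y₀ := p₀) hxt
  refine ⟨η, hη, hq, (hint c.logNorm l ?_).trans_le hl0⟩
  refine (c.tendsto_log_iter_smul hz hz0 (inv_ne_zero hz0') hl).congr fun n => ?_
  rw [birkhoffAverage, birkhoffSum_logNorm, smul_eq_mul]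

end BundleCocycle

variable [CompactSpace X] [TopologicalSpace.MetrizableSpace X] [MeasurableSpace X] [BorelSpace X]
  [FiniteDimensional ℝ H]

/-- If non-expanding ergodic measures `μ n` of cocycles `c n` are given, with `c n` converging to
`c₀`, then some accumulation point of the `μ n` is non-expanding for `c₀`. -/
theorem exists_mapClusterPt_not_expanding {d : ℕ}
    (hV : IsClosed {p : X × H | p.2 ∈ V p.1}) (hd : ∀ x, Module.finrank ℝ (V x) = d)
    {c : ℕ → BundleCocycle V} {c₀ : BundleCocycle V}
    (hmap : Tendsto (fun n => (c n).sphereMap) atTop (𝓝 c₀.sphereMap))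
    (hlog : Tendsto (fun n => (c n).logNorm) atTop (𝓝 c₀.logNorm))
    {μ : ℕ → ProbabilityMeasure X} (hμ : ∀ n, Ergodic (c n).base (μ n : Measure X))
    (hexp : ∀ n, ¬ (c n).Expanding (μ n : Measure X)) :
    ∃ μ₀ : ProbabilityMeasure X, MapClusterPt μ₀ atTop μ ∧ ¬ c₀.Expanding (μ₀ : Measure X) := by
  have : CompactSpace (sphereSet V) := isCompact_iff_compactSpace.1 (isCompact_sphereSet hV)
  let _ : MeasurableSpace (sphereSet V) := borel _
  have : BorelSpace (sphereSet V) := ⟨rfl⟩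
  choose η hη hq hint using fun n =>
    (c n).exists_lift_integral_logNorm_nonpos hV hd (hμ n) (hexp n)
  let u : Ultrafilter ℕ := Ultrafilter.of atTop
  have hu : (u : Filter ℕ) ≤ atTop := Ultrafilter.of_le atTop
  -- The limit is taken upstairs, on the sphere bundle; its projection is then the required
  -- accumulation point.
  obtain ⟨η₀, -, hη₀⟩ := isCompact_univ.ultrafilter_le_nhds (u.map η) (by simp)
  have hη₀' : Tendsto η u (𝓝 η₀) := hη₀
  have hq₀ : Continuous fun p : sphereSet V => p.1.1 := by fun_prop
  have hinv : MeasurePreserving c₀.sphereMap (η₀ : Measure (sphereSet V))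
      (η₀ : Measure (sphereSet V)) := by
    refine measurePreserving_of_tendsto hη₀' (hmap.mono_left hu) fun φ => ?_
    refine tendsto_const_nhds.congr fun n => ?_
    rw [← integral_map (φ := (c n).sphereMap) (hη n).aemeasurable
      φ.continuous.measurable.aestronglyMeasurable, (hη n).map_eq, sub_self]
  have hnonpos : ∫ p, c₀.logNorm p ∂(η₀ : Measure (sphereSet V)) ≤ 0 :=
    le_of_tendsto' (tendsto_integral_of_tendstoUniformly hη₀' (hlog.mono_left hu)) hint
  refine ⟨η₀.map hq₀.measurable.aemeasurable, ?_, fun hexp₀ => ?_⟩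
  · have h1 := ProbabilityMeasure.tendsto_map_of_tendsto_of_continuous η η₀ hη₀' hq₀
    have h2 : (fun n => (η n).map hq₀.measurable.aemeasurable) = μ := by
      funext n
      exact Subtype.ext (hq n)
    rw [h2] at h1
    exact h1.mapClusterPt.mono hu
  · exact absurd (c₀.integral_logNorm_pos hinv hexp₀) (not_lt.2 hnonpos)

end Sphere

/-! ### Compactness of bounded parts of the tangent bundle -/

section BoundedTangent

variable {E : Type*} [NormedAddCommGroup E] [NormedSpace ℝ E]
  {M : Type*} [TopologicalSpace M] [ChartedSpace E M] [IsManifold 𝓘(ℝ, E) 1 M]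
  [RiemannianBundle (fun x : M => TangentSpace 𝓘(ℝ, E) x)]
  [IsContinuousRiemannianBundle E (fun x : M => TangentSpace 𝓘(ℝ, E) x)]

theorem continuous_norm_tangentBundle :
    Continuous fun v : TangentBundle 𝓘(ℝ, E) M => ‖v.2‖ := by
  have h : Continuous fun v : TangentBundle 𝓘(ℝ, E) M => inner ℝ v.2 v.2 :=
    Continuous.inner_bundle (F := E) (E := fun x : M => TangentSpace 𝓘(ℝ, E) x)
      (b := fun v : TangentBundle 𝓘(ℝ, E) M => v.1) (v := fun v => v.2) (w := fun v => v.2)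
      continuous_id continuous_id
  simpa only [norm_eq_sqrt_real_inner] using h.sqrt

/-- In a trivialization over a compact neighbourhood, the Riemannian norm controls the norm of `E`
up to a constant, so vectors of norm `≤ R` lie in a compact set. Finitely many such neighbourhoods
cover `M`. -/
theorem isCompact_norm_tangentBundle_le [FiniteDimensional ℝ E] [CompactSpace M] (R : ℝ) :
    IsCompact {v : TangentBundle 𝓘(ℝ, E) M | ‖v.2‖ ≤ R} := by
  have hloc : ∀ x : M, ∃ U ∈ 𝓝 x, ∃ K : Set (TangentBundle 𝓘(ℝ, E) M), IsCompact K ∧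
      ∀ v : TangentBundle 𝓘(ℝ, E) M, v.1 ∈ U → ‖v.2‖ ≤ R → v ∈ K := by
    intro x
    have := Manifold.locallyCompact_of_finiteDimensional (M := M) 𝓘(ℝ, E)
    obtain ⟨C, hC, hCx⟩ := eventually_norm_trivializationAt_lt E
      (fun x : M => TangentSpace 𝓘(ℝ, E) x) x
    set t := trivializationAt E (fun x : M => TangentSpace 𝓘(ℝ, E) x) x with ht
    have hbase : ∀ᶠ y in 𝓝 x, y ∈ t.baseSet :=
      t.open_baseSet.mem_nhds (FiberBundle.mem_baseSet_trivializationAt' x)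
    obtain ⟨U, hU, hUs, hUc⟩ := local_compact_nhds (hCx.and hbase)
    refine ⟨U, hU, t.toOpenPartialHomeomorph.symm '' (U ×ˢ Metric.closedBall 0 (C * R)), ?_, ?_⟩
    · refine (hUc.prod (isCompact_closedBall _ _)).image_of_continuousOn
        (t.toOpenPartialHomeomorph.continuousOn_symm.mono ?_)
      rintro ⟨y, a⟩ ⟨hy, -⟩
      exact t.mem_target.2 (hUs hy).2
    · intro v hv hvR
      have hvb := (hUs hv).2
      refine ⟨t v, ⟨?_, ?_⟩, ?_⟩
      · rw [t.coe_fst' hvb]; exact hv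
      · have h1 : (t v).2 = t.continuousLinearMapAt ℝ v.1 v.2 := by
          rw [Trivialization.continuousLinearMapAt_apply, Trivialization.coe_linearMapAt_of_mem t hvb]
        rw [mem_closedBall_zero_iff, h1]
        refine (ContinuousLinearMap.le_opNorm _ _).trans ?_
        exact mul_le_mul (hUs hv).1.le hvR (norm_nonneg _) hC.le
      · exact t.toOpenPartialHomeomorph.left_inv (t.mem_source.2 hvb)
  choose U hU K hK hUK using hloc
  obtain ⟨s, hs⟩ := CompactSpace.elim_nhds_subcover U hU
  refine (s.isCompact_biUnion fun x _ => hK x).of_isClosed_subset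
    (isClosed_le continuous_norm_tangentBundle continuous_const) fun v hv => ?_
  have : v.1 ∈ ⋃ x ∈ s, U x := by rw [hs]; trivial
  obtain ⟨x, hx, hvx⟩ := mem_iUnion₂.1 this
  exact mem_iUnion₂.2 ⟨x, hx, hUK x v hvx hv⟩

end BoundedTangent

/-! ### Immersions into a normed space -/

section Immersion

variable {E : Type*} [NormedAddCommGroup E] [NormedSpace ℝ E]
  {M : Type*} [TopologicalSpace M] [ChartedSpace E M]
  {H : Type*} [NormedAddCommGroup H] [NormedSpace ℝ H]

/-- The differential of `e : M → H` at `x`, as a linear map with values in `H`. -/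
noncomputable def diffLin (e : M → H) (x : M) : TangentSpace 𝓘(ℝ, E) x →ₗ[ℝ] H :=
  (mfderiv 𝓘(ℝ, E) 𝓘(ℝ, H) e x).toLinearMap

/-- The map from the tangent bundle to `M × H` induced by a map `e : M → H`. -/
noncomputable def tangentToProd (e : M → H) (v : TangentBundle 𝓘(ℝ, E) M) : M × H :=
  (v.1, diffLin e v.1 v.2)

variable {e : M → H}

theorem continuous_tangentToProd [IsManifold 𝓘(ℝ, E) 1 M] (he : ContMDiff 𝓘(ℝ, E) 𝓘(ℝ, H) 1 e) :
    Continuous (tangentToProd (E := E) e) := by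
  refine Continuous.prodMk (FiberBundle.continuous_proj E (TangentSpace 𝓘(ℝ, E) : M → Type _)) ?_
  have h1 := he.continuous_tangentMap le_rfl
  have h2 := (tangentBundleModelSpaceHomeomorph 𝓘(ℝ, H)).continuous.comp h1
  exact continuous_snd.comp (show Continuous (fun v : TangentBundle 𝓘(ℝ, E) M =>
    ((e v.1, diffLin e v.1 v.2) : H × H)) from h2)

theorem injective_tangentToProd
    (hinj : ∀ x, Function.Injective (mfderiv 𝓘(ℝ, E) 𝓘(ℝ, H) e x)) :
    Function.Injective (tangentToProd (E := E) e) := by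
  rintro ⟨x, v⟩ ⟨y, w⟩ h
  obtain ⟨h1, h2⟩ := Prod.mk.inj h
  change x = y at h1
  subst h1
  exact congrArg _ (hinj x h2)

variable [IsManifold 𝓘(ℝ, E) 1 M] [FiniteDimensional ℝ E] [CompactSpace M]
  [RiemannianBundle (fun x : M => TangentSpace 𝓘(ℝ, E) x)]
  [IsContinuousRiemannianBundle E (fun x : M => TangentSpace 𝓘(ℝ, E) x)]

theorem exists_norm_diffLin_le (he : ContMDiff 𝓘(ℝ, E) 𝓘(ℝ, H) 1 e) :
    ∃ C > 0, ∀ (x : M) (v : TangentSpace 𝓘(ℝ, E) x), ‖diffLin e x v‖ ≤ C * ‖v‖ := by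
  obtain ⟨C, hC⟩ := (isCompact_norm_tangentBundle_le (E := E) (M := M) 1).exists_bound_of_continuousOn
    (continuous_snd.comp (continuous_tangentToProd he)).continuousOn
  refine ⟨max C 1, lt_max_of_lt_right one_pos, fun x v => ?_⟩
  by_cases hv : v = 0
  · simp [hv]
  have hv' : ‖v‖ ≠ 0 := norm_ne_zero_iff.2 hv
  have h1 := hC ⟨x, ‖v‖⁻¹ • v⟩ (by simp [norm_smul, hv'])
  change ‖diffLin e x (‖v‖⁻¹ • v)‖ ≤ C at h1
  rw [map_smul, norm_smul, norm_inv, norm_norm, inv_mul_le_iff₀ (by positivity)] at h1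
  rw [mul_comm]
  exact h1.trans (by gcongr; exact le_max_left _ _)

/-- On the compact unit sphere bundle, `‖diffLin e x v‖` is continuous and never zero; homogeneity
does the rest. -/
theorem exists_norm_le_norm_diffLin (he : ContMDiff 𝓘(ℝ, E) 𝓘(ℝ, H) 1 e)
    (hinj : ∀ x, Function.Injective (mfderiv 𝓘(ℝ, E) 𝓘(ℝ, H) e x)) :
    ∃ C > 0, ∀ (x : M) (v : TangentSpace 𝓘(ℝ, E) x), ‖v‖ ≤ C * ‖diffLin e x v‖ := by
  have hc : IsCompact {v : TangentBundle 𝓘(ℝ, E) M | ‖v.2‖ = 1} :=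
    (isCompact_norm_tangentBundle_le (E := E) (M := M) 1).of_isClosed_subset
      (isClosed_eq continuous_norm_tangentBundle continuous_const) fun v hv => le_of_eq hv
  have h0 : ∀ v : TangentBundle 𝓘(ℝ, E) M, ‖v.2‖ = 1 → ‖(tangentToProd e v).2‖ ≠ 0 := by
    rintro ⟨x, v⟩ hv h
    have h1 : diffLin e x v = 0 := norm_eq_zero.1 h
    have h2 : v = 0 := hinj x (h1.trans (map_zero (mfderiv 𝓘(ℝ, E) 𝓘(ℝ, H) e x)).symm)
    simp [h2] at hv
  obtain ⟨C, hC⟩ := hc.exists_bound_of_continuousOn (f := fun v => ‖(tangentToProd e v).2‖⁻¹)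
    ((continuous_snd.comp (continuous_tangentToProd he)).norm.continuousOn.inv₀ fun v hv => h0 v hv)
  refine ⟨max C 1, lt_max_of_lt_right one_pos, fun x v => ?_⟩
  by_cases hv : v = 0
  · simp [hv]
  have hv' : ‖v‖ ≠ 0 := norm_ne_zero_iff.2 hv
  have hn : ‖‖v‖⁻¹ • v‖ = 1 := by simp [norm_smul, hv']
  have h1 := hC ⟨x, ‖v‖⁻¹ • v⟩ hn
  have h2 := h0 ⟨x, ‖v‖⁻¹ • v⟩ hn
  change ‖‖diffLin e x (‖v‖⁻¹ • v)‖⁻¹‖ ≤ C at h1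
  change ‖diffLin e x (‖v‖⁻¹ • v)‖ ≠ 0 at h2
  have h4 : ‖diffLin e x (‖v‖⁻¹ • v)‖ = ‖v‖⁻¹ * ‖diffLin e x v‖ := by
    rw [map_smul, norm_smul, norm_inv, norm_norm]
  rw [h4] at h1 h2
  have h3 : 0 < ‖diffLin e x v‖ :=
    lt_of_le_of_ne (norm_nonneg _) fun h => h2 (by rw [← h, mul_zero])
  rw [norm_inv, norm_mul, norm_inv, norm_norm, norm_norm, mul_inv, inv_inv, ← div_eq_mul_inv, div_le_iff₀ h3] at h1
  exact h1.trans (by gcongr; exact le_max_left _ _)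

/-- The lower bound on the differential makes the map proper: preimages of compact sets are closed
and bounded in the Riemannian norm. -/
theorem isClosedEmbedding_tangentToProd [T2Space M] [FiniteDimensional ℝ H]
    (he : ContMDiff 𝓘(ℝ, E) 𝓘(ℝ, H) 1 e)
    (hinj : ∀ x, Function.Injective (mfderiv 𝓘(ℝ, E) 𝓘(ℝ, H) e x)) :
    IsClosedEmbedding (tangentToProd (E := E) e) := by
  have hcont := continuous_tangentToProd he
  refine .of_continuous_injective_isClosedMap hcont (injective_tangentToProd hinj) ?_
  refine IsProperMap.isClosedMap (isProperMap_iff_isCompact_preimage.2 ⟨hcont, fun K hK => ?_⟩)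
  obtain ⟨C, hC, hCe⟩ := exists_norm_le_norm_diffLin he hinj
  obtain ⟨R, hR⟩ := hK.exists_bound_of_continuousOn continuous_snd.continuousOn
  refine (isCompact_norm_tangentBundle_le (E := E) (M := M) (C * R)).of_isClosed_subset
    (hK.isClosed.preimage hcont) fun v hv => ?_
  exact (hCe v.1 v.2).trans (by gcongr; exact hR _ hv)

end Immersion

/-! ### The derivative as a cocycle in the ambient space -/

section TangentCocycle

variable {E : Type*} [NormedAddCommGroup E] [NormedSpace ℝ E]
  {M : Type*} [TopologicalSpace M] [ChartedSpace E M]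
  {H : Type*} [NormedAddCommGroup H] [InnerProductSpace ℝ H] {e : M → H}

variable (E) in
/-- The image in `H` of the tangent space at `x` under the differential of `e`. -/
noncomputable def tangentRange (e : M → H) (x : M) : Submodule ℝ H :=
  LinearMap.range (diffLin (E := E) e x)

theorem setOf_mem_tangentRange :
    {p : M × H | p.2 ∈ tangentRange E e p.1} = range (tangentToProd (E := E) e) := by
  ext ⟨x, z⟩
  constructor
  · rintro ⟨v, hv⟩
    exact ⟨⟨x, v⟩, Prod.ext rfl hv⟩
  · rintro ⟨⟨y, v⟩, h⟩
    obtain ⟨h1, h2⟩ := Prod.mk.inj h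
    change y = x at h1
    subst h1
    exact ⟨v, h2⟩

theorem finrank_tangentRange (hι : Function.Injective (tangentToProd (E := E) e)) (x : M) :
    Module.finrank ℝ (tangentRange E e x) = Module.finrank ℝ E := by
  refine LinearMap.finrank_range_of_inj (f := diffLin (E := E) e x) fun v w h => ?_
  have h1 := @hι ⟨x, v⟩ ⟨x, w⟩ (Prod.ext rfl h)
  simpa using h1

/-- The values off the tangent range are arbitrary, which is harmless: the axioms of `BundleCocycle`
constrain `lin x` only on `V x`. -/
theorem exists_leftInverse_diffLin (hι : Function.Injective (tangentToProd (E := E) e)) (x : M) :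
    ∃ J : H →ₗ[ℝ] TangentSpace 𝓘(ℝ, E) x, ∀ v, J (diffLin e x v) = v := by
  obtain ⟨J, hJ⟩ := LinearMap.exists_leftInverse_of_injective (diffLin (E := E) e x)
    (LinearMap.ker_eq_bot.2 fun v w h => by
      have h1 := @hι ⟨x, v⟩ ⟨x, w⟩ (Prod.ext rfl h)
      simpa using h1)
  exact ⟨J, fun v => LinearMap.congr_fun hJ v⟩

variable [IsManifold 𝓘(ℝ, E) ∞ M]

/-- The tangent vector that `tangentToProd e` sends to a given point of its range. -/
noncomputable def tangentOfProd (hι : IsClosedEmbedding (tangentToProd (E := E) e))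
    (p : {p : M × H | p.2 ∈ tangentRange E e p.1}) : TangentBundle 𝓘(ℝ, E) M :=
  hι.isEmbedding.toHomeomorph.symm ⟨p.1, by rw [← setOf_mem_tangentRange]; exact p.2⟩

theorem continuous_tangentOfProd (hι : IsClosedEmbedding (tangentToProd (E := E) e)) :
    Continuous (tangentOfProd hι) :=
  hι.isEmbedding.toHomeomorph.symm.continuous.comp (continuous_subtype_val.subtype_mk _)

theorem tangentToProd_tangentOfProd (hι : IsClosedEmbedding (tangentToProd (E := E) e))
    (p : {p : M × H | p.2 ∈ tangentRange E e p.1}) :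
    tangentToProd e (tangentOfProd hι p) = p.1 :=
  congrArg Subtype.val (hι.isEmbedding.toHomeomorph.apply_symm_apply
    ⟨p.1, by rw [← setOf_mem_tangentRange]; exact p.2⟩)

/-- The linear map of `H` that corresponds to the differential of `g` at `x`. -/
noncomputable def transportedDiff (hι : IsClosedEmbedding (tangentToProd (E := E) e)) (g : M → M)
    (x : M) : H →ₗ[ℝ] H :=
  diffLin e (g x) ∘ₗ (mfderiv 𝓘(ℝ, E) 𝓘(ℝ, E) g x).toLinearMap ∘ₗ
    (exists_leftInverse_diffLin hι.injective x).choose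

theorem transportedDiff_diffLin (hι : IsClosedEmbedding (tangentToProd (E := E) e)) (g : M → M)
    (x : M) (v : TangentSpace 𝓘(ℝ, E) x) :
    transportedDiff hι g x (diffLin e x v)
      = diffLin e (g x) (mfderiv 𝓘(ℝ, E) 𝓘(ℝ, E) g x v) := by
  simp only [transportedDiff, LinearMap.comp_apply,
    (exists_leftInverse_diffLin hι.injective x).choose_spec]
  rfl

/-- On the bundle the arbitrary left inverse drops out, and continuity in the point and in `g` can
be read off from `tangentC g`. -/
theorem transportedDiff_eq (hι : IsClosedEmbedding (tangentToProd (E := E) e))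
    (g : C^2⟮𝓘(ℝ, E), M; 𝓘(ℝ, E), M⟯) (p : {p : M × H | p.2 ∈ tangentRange E e p.1}) :
    transportedDiff hι g p.1.1 p.1.2 = (tangentToProd e (tangentC g (tangentOfProd hι p))).2 := by
  have h := tangentToProd_tangentOfProd hι p
  rw [← h]
  exact transportedDiff_diffLin hι g _ _

/-- The derivative cocycle of a local diffeomorphism `g` of `M`, transported by an immersion of `M`
into an inner product space. -/
noncomputable def diffCocycle (hι : IsClosedEmbedding (tangentToProd (E := E) e))
    (g : C^2⟮𝓘(ℝ, E), M; 𝓘(ℝ, E), M⟯) (hg : IsLocalDiffeomorph 𝓘(ℝ, E) 𝓘(ℝ, E) 2 g) :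
    BundleCocycle (tangentRange E e) where
  base := ⟨g, g.contMDiff.continuous⟩
  lin := transportedDiff hι g
  continuousOn_lin := by
    have hc : Continuous (tangentToProd (E := E) e) := hι.continuous
    rw [continuousOn_iff_continuous_domRestrict]
    have h1 : Continuous fun p => (tangentToProd e (tangentC g (tangentOfProd hι p))).2 :=
      continuous_snd.comp (hc.comp ((tangentC g).continuous.comp (continuous_tangentOfProd hι)))
    refine h1.congr fun p => ?_
    exact (transportedDiff_eq hι g p).symm
  lin_mem := by
    rintro x _ ⟨v, rfl⟩
    exact ⟨_, (transportedDiff_diffLin hι g x v).symm⟩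
  eq_zero_of_lin_eq_zero := by
    rintro x _ ⟨v, rfl⟩ h
    rw [transportedDiff_diffLin] at h
    have h1 : mfderiv 𝓘(ℝ, E) 𝓘(ℝ, E) g x v = 0 := by
      have := @hι.injective ⟨g x, mfderiv 𝓘(ℝ, E) 𝓘(ℝ, E) g x v⟩ ⟨g x, 0⟩
        (Prod.ext rfl (h.trans (map_zero _).symm))
      simpa using this
    have h2 : v = 0 := (hg.mfderivToContinuousLinearEquiv two_ne_zero x).injective
      (h1.trans (map_zero _).symm)
    rw [h2, map_zero]

theorem tangentToProd_tangentMap_iterate (hι : IsClosedEmbedding (tangentToProd (E := E) e))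
    (g : C^2⟮𝓘(ℝ, E), M; 𝓘(ℝ, E), M⟯) (hg : IsLocalDiffeomorph 𝓘(ℝ, E) 𝓘(ℝ, E) 2 g)
    (x : M) (v : TangentSpace 𝓘(ℝ, E) x) (n : ℕ) :
    tangentToProd e (tangentMap 𝓘(ℝ, E) 𝓘(ℝ, E) (g^[n]) ⟨x, v⟩)
      = (g^[n] x, (diffCocycle hι g hg).iter x (diffLin e x v) n) := by
  have hgd : MDifferentiable 𝓘(ℝ, E) 𝓘(ℝ, E) g := g.contMDiff.mdifferentiable two_ne_zero
  have hgn : ∀ n, MDifferentiable 𝓘(ℝ, E) 𝓘(ℝ, E) (g^[n]) := fun n => by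
    induction n with
    | zero => exact mdifferentiable_id
    | succ n ih => rw [Function.iterate_succ']; exact hgd.comp ih
  induction n with
  | zero =>
    rw [Function.iterate_zero, tangentMap_id]
    rfl
  | succ n ih =>
    rw [Function.iterate_succ', tangentMap_comp hgd (hgn n), Function.comp_apply]
    set u := tangentMap 𝓘(ℝ, E) 𝓘(ℝ, E) (g^[n]) ⟨x, v⟩ with hu
    have h1 : (diffCocycle hι g hg).iter x (diffLin e x v) n = diffLin e u.1 u.2 :=
      (congrArg Prod.snd ih).symm
    have h2 : u.1 = g^[n] x := rfl
    refine Prod.ext rfl ?_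
    change _ = transportedDiff hι g (g^[n] x) ((diffCocycle hι g hg).iter x (diffLin e x v) n)
    rw [h1, ← h2, transportedDiff_diffLin]
    rfl

/-- `TM` is locally compact, so evaluation is jointly continuous for the compact-open topology.
Convergence in `C^1` thus carries over to the cocycles. -/
theorem continuous_eval_tangentC [FiniteDimensional ℝ E]
    (hι : IsClosedEmbedding (tangentToProd (E := E) e)) {P : Type*} [TopologicalSpace P]
    {g : P → C^2⟮𝓘(ℝ, E), M; 𝓘(ℝ, E), M⟯} (h : Continuous fun k => tangentC (g k)) :
    Continuous fun a : P × sphereSet (tangentRange E e) =>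
      tangentToProd e (tangentC (g a.1) (tangentOfProd hι ⟨a.2.1, a.2.2.1⟩)) := by
  have : LocallyCompactSpace (TangentBundle 𝓘(ℝ, E) M) :=
    Manifold.locallyCompact_of_finiteDimensional 𝓘(ℝ, E).tangent
  have hs : Continuous fun p : sphereSet (tangentRange E e) => tangentOfProd hι ⟨p.1, p.2.1⟩ :=
    (continuous_tangentOfProd hι).comp (continuous_subtype_val.subtype_mk _)
  exact hι.continuous.comp ((h.comp continuous_fst).eval (hs.comp continuous_snd))

theorem continuous_lin_diffCocycle [FiniteDimensional ℝ E]
    (hι : IsClosedEmbedding (tangentToProd (E := E) e)) {P : Type*} [TopologicalSpace P]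
    {g : P → C^2⟮𝓘(ℝ, E), M; 𝓘(ℝ, E), M⟯} (h : Continuous fun k => tangentC (g k))
    (hg : ∀ k, IsLocalDiffeomorph 𝓘(ℝ, E) 𝓘(ℝ, E) 2 (g k)) :
    Continuous fun a : P × sphereSet (tangentRange E e) =>
      (diffCocycle hι (g a.1) (hg a.1)).lin a.2.1.1 a.2.1.2 :=
  (continuous_snd.comp (continuous_eval_tangentC hι h)).congr fun a =>
    (transportedDiff_eq hι (g a.1) ⟨a.2.1, a.2.2.1⟩).symm

theorem continuous_base_diffCocycle [FiniteDimensional ℝ E]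
    (hι : IsClosedEmbedding (tangentToProd (E := E) e)) {P : Type*} [TopologicalSpace P]
    {g : P → C^2⟮𝓘(ℝ, E), M; 𝓘(ℝ, E), M⟯} (h : Continuous fun k => tangentC (g k))
    (hg : ∀ k, IsLocalDiffeomorph 𝓘(ℝ, E) 𝓘(ℝ, E) 2 (g k)) :
    Continuous fun a : P × sphereSet (tangentRange E e) =>
      (diffCocycle hι (g a.1) (hg a.1)).base a.2.1.1 :=
  (continuous_fst.comp (continuous_eval_tangentC hι h)).congr fun a =>
    congrArg (g a.1) (congrArg Prod.fst (tangentToProd_tangentOfProd hι ⟨a.2.1, a.2.2.1⟩))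

theorem continuous_sphereMap_diffCocycle [FiniteDimensional ℝ E]
    (hι : IsClosedEmbedding (tangentToProd (E := E) e)) {P : Type*} [TopologicalSpace P]
    {g : P → C^2⟮𝓘(ℝ, E), M; 𝓘(ℝ, E), M⟯} (h : Continuous fun k => tangentC (g k))
    (hg : ∀ k, IsLocalDiffeomorph 𝓘(ℝ, E) 𝓘(ℝ, E) 2 (g k)) :
    Continuous fun k => (diffCocycle hι (g k) (hg k)).sphereMap :=
  BundleCocycle.continuous_sphereMap_of_param (continuous_base_diffCocycle hι h hg)
    (continuous_lin_diffCocycle hι h hg)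

theorem continuous_logNorm_diffCocycle [FiniteDimensional ℝ E]
    (hι : IsClosedEmbedding (tangentToProd (E := E) e)) {P : Type*} [TopologicalSpace P]
    {g : P → C^2⟮𝓘(ℝ, E), M; 𝓘(ℝ, E), M⟯} (h : Continuous fun k => tangentC (g k))
    (hg : ∀ k, IsLocalDiffeomorph 𝓘(ℝ, E) 𝓘(ℝ, E) 2 (g k)) :
    Continuous fun k => (diffCocycle hι (g k) (hg k)).logNorm :=
  BundleCocycle.continuous_logNorm_of_param (continuous_lin_diffCocycle hι h hg)

end TangentCocycle

/-! ### Independence of the exponents from the norm -/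

section Expanding

variable {E : Type*} [NormedAddCommGroup E] [NormedSpace ℝ E] [FiniteDimensional ℝ E]
  {M : Type*} [EMetricSpace M] [CompactSpace M] [ChartedSpace E M] [IsManifold 𝓘(ℝ, E) ∞ M]
  [RiemannianBundle (fun x : M => TangentSpace 𝓘(ℝ, E) x)]
  [IsContinuousRiemannianBundle E (fun x : M => TangentSpace 𝓘(ℝ, E) x)]
  {H : Type*} [NormedAddCommGroup H] [InnerProductSpace ℝ H] {e : M → H}

/-- By compactness, the Riemannian and the ambient norm are uniformly comparable on tangent vectors,
and bounded factors do not affect exponents. -/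
theorem hasLyapunovExponent_iff (he : ContMDiff 𝓘(ℝ, E) 𝓘(ℝ, H) 1 e)
    (hinj : ∀ x, Function.Injective (mfderiv 𝓘(ℝ, E) 𝓘(ℝ, H) e x))
    (hι : IsClosedEmbedding (tangentToProd (E := E) e))
    (g : C^2⟮𝓘(ℝ, E), M; 𝓘(ℝ, E), M⟯) (hg : IsLocalDiffeomorph 𝓘(ℝ, E) 𝓘(ℝ, E) 2 g)
    (x : M) {v : TangentSpace 𝓘(ℝ, E) x} (hv : v ≠ 0) (l : ℝ) :
    HasLyapunovExponent E g x v l ↔ Tendsto (fun n : ℕ => (n : ℝ)⁻¹ *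
      Real.log ‖(diffCocycle hι g hg).iter x (diffLin e x v) n‖) atTop (𝓝 l) := by
  obtain ⟨C, hC, hCe⟩ := exists_norm_diffLin_le (E := E) he
  obtain ⟨C', hC', hCe'⟩ := exists_norm_le_norm_diffLin (E := E) he hinj
  have hit : ∀ n, (diffCocycle hι g hg).iter x (diffLin e x v) n
      = diffLin e (g^[n] x) (mfderiv 𝓘(ℝ, E) 𝓘(ℝ, E) (g^[n]) x v) := fun n =>
    (congrArg Prod.snd (tangentToProd_tangentMap_iterate hι g hg x v n)).symm
  have hv0 : diffLin e x v ≠ 0 := fun h =>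
    hv (hinj x (h.trans (map_zero (mfderiv 𝓘(ℝ, E) 𝓘(ℝ, H) e x)).symm))
  have hpos : ∀ n, 0 < ‖(diffCocycle hι g hg).iter x (diffLin e x v) n‖ := fun n =>
    norm_pos_iff.2 ((diffCocycle hι g hg).iter_ne_zero ⟨v, rfl⟩ hv0 n)
  have hpos' : ∀ n, 0 < ‖mfderiv 𝓘(ℝ, E) 𝓘(ℝ, E) (g^[n]) x v‖ := fun n => by
    have h1 := (hpos n).trans_le ((le_of_eq (congrArg norm (hit n))).trans (hCe _ _))
    exact pos_of_mul_pos_right h1 hC.le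
  have h1 : (fun n => ‖(diffCocycle hι g hg).iter x (diffLin e x v) n‖) =O[atTop]
      fun n => ‖mfderiv 𝓘(ℝ, E) 𝓘(ℝ, E) (g^[n]) x v‖ :=
    Asymptotics.IsBigO.of_bound C (Eventually.of_forall fun n => by
      rw [norm_norm, norm_norm, hit]; exact hCe _ _)
  have h2 : (fun n => ‖mfderiv 𝓘(ℝ, E) 𝓘(ℝ, E) (g^[n]) x v‖) =O[atTop]
      fun n => ‖(diffCocycle hι g hg).iter x (diffLin e x v) n‖ :=
    Asymptotics.IsBigO.of_bound C' (Eventually.of_forall fun n => by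
      rw [norm_norm, norm_norm, hit]; exact hCe' _ _)
  simp only [HasLyapunovExponent, one_div]
  exact ⟨tendsto_log_of_isTheta hpos' hpos h2 h1, tendsto_log_of_isTheta hpos hpos' h1 h2⟩

theorem isExpanding_iff [MeasurableSpace M] (he : ContMDiff 𝓘(ℝ, E) 𝓘(ℝ, H) 1 e)
    (hinj : ∀ x, Function.Injective (mfderiv 𝓘(ℝ, E) 𝓘(ℝ, H) e x))
    (hι : IsClosedEmbedding (tangentToProd (E := E) e))
    (g : C^2⟮𝓘(ℝ, E), M; 𝓘(ℝ, E), M⟯) (hg : IsLocalDiffeomorph 𝓘(ℝ, E) 𝓘(ℝ, E) 2 g)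
    (μ : ProbabilityMeasure M) :
    IsExpanding E g μ ↔ (diffCocycle hι g hg).Expanding (μ : Measure M) := by
  refine eventually_congr (Eventually.of_forall fun x => ?_)
  constructor
  · rintro h _ ⟨v, rfl⟩ hv
    have hv' : v ≠ 0 := fun h0 => hv (by rw [h0, map_zero])
    obtain ⟨l, hl, hlx⟩ := h v hv'
    exact ⟨l, hl, (hasLyapunovExponent_iff he hinj hι g hg x hv' l).1 hlx⟩
  · intro h v hv
    have hv' : diffLin e x v ≠ 0 := fun h =>
      hv (hinj x (h.trans (map_zero (mfderiv 𝓘(ℝ, E) 𝓘(ℝ, H) e x)).symm))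
    obtain ⟨l, hl, hlx⟩ := h _ ⟨v, rfl⟩ hv'
    exact ⟨l, hl, (hasLyapunovExponent_iff he hinj hι g hg x hv l).2 hlx⟩

end Expanding

/-! ### Countable neighbourhood bases of the `C^1` and `C^2` topologies -/

section Countability

theorem isCountablyGenerated_nhds_continuousMap {X Y : Type*} [TopologicalSpace X]
    [TopologicalSpace Y] [SecondCountableTopology X] [LocallyCompactSpace X]
    [SecondCountableTopology Y] (f : C(X, Y)) : (𝓝 f).IsCountablyGenerated :=
  inferInstance

theorem secondCountableTopology_tangentBundle {𝕜 : Type*} [NontriviallyNormedField 𝕜]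
    {E : Type*} [NormedAddCommGroup E] [NormedSpace 𝕜 E] [SecondCountableTopology E]
    {H : Type*} [TopologicalSpace H] [SecondCountableTopology H] (I : ModelWithCorners 𝕜 E H)
    (M : Type*) [TopologicalSpace M] [ChartedSpace H M] [IsManifold I 1 M]
    [SecondCountableTopology M] : SecondCountableTopology (TangentBundle I M) := by
  obtain ⟨s, hs, hsU⟩ := TopologicalSpace.countable_cover_nhds
    (f := fun x : M => (chartAt H x).source) fun x => chart_source_mem_nhds H x
  have : SecondCountableTopology (ModelProd H E) := inferInstanceAs (SecondCountableTopology (H × E))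
  refine ChartedSpace.secondCountable_of_countable_cover (ModelProd H E)
    (s := (fun x => (⟨x, 0⟩ : TangentBundle I M)) '' s) ?_ (hs.image _)
  refine eq_univ_of_forall fun v => ?_
  have hv : v.1 ∈ ⋃ x ∈ s, (chartAt H x).source := by rw [hsU]; trivial
  obtain ⟨x, hx, hvx⟩ := mem_iUnion₂.1 hv
  exact mem_iUnion₂.2 ⟨⟨x, 0⟩, mem_image_of_mem _ hx, (TangentBundle.mem_chart_source_iff _ _).2 hvx⟩

variable {E : Type*} [NormedAddCommGroup E] [NormedSpace ℝ E] [FiniteDimensional ℝ E]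
  {M : Type*} [TopologicalSpace M] [ChartedSpace E M] [IsManifold 𝓘(ℝ, E) ∞ M]

theorem isCountablyGenerated_nhds_c1Topology [SecondCountableTopology M]
    (f : C^2⟮𝓘(ℝ, E), M; 𝓘(ℝ, E), M⟯) :
    (@nhds _ (c1Topology E M) f).IsCountablyGenerated := by
  have : LocallyCompactSpace (TangentBundle 𝓘(ℝ, E) M) :=
    Manifold.locallyCompact_of_finiteDimensional 𝓘(ℝ, E).tangent
  have : ProperSpace E := FiniteDimensional.proper ℝ E
  have : SecondCountableTopology E := inferInstance
  have : SecondCountableTopology (TangentBundle 𝓘(ℝ, E) M) :=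
    secondCountableTopology_tangentBundle 𝓘(ℝ, E) M
  have := isCountablyGenerated_nhds_continuousMap (tangentC f)
  rw [c1Topology, nhds_induced]
  exact Filter.comap.isCountablyGenerated _ _

theorem isCountablyGenerated_nhds_c2Topology [SecondCountableTopology M]
    (f : C^2⟮𝓘(ℝ, E), M; 𝓘(ℝ, E), M⟯) :
    (@nhds _ (c2Topology E M) f).IsCountablyGenerated := by
  have : ProperSpace E := FiniteDimensional.proper ℝ E
  have : SecondCountableTopology E := inferInstance
  have : SecondCountableTopology (ModelProd E E) := inferInstanceAs (SecondCountableTopology (E × E))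
  have : SecondCountableTopology (TangentBundle 𝓘(ℝ, E) M) :=
    secondCountableTopology_tangentBundle 𝓘(ℝ, E) M
  have : SecondCountableTopology (TangentBundle 𝓘(ℝ, E).tangent (TangentBundle 𝓘(ℝ, E) M)) :=
    secondCountableTopology_tangentBundle 𝓘(ℝ, E).tangent (TangentBundle 𝓘(ℝ, E) M)
  have : LocallyCompactSpace (TangentBundle 𝓘(ℝ, E).tangent (TangentBundle 𝓘(ℝ, E) M)) :=
    Manifold.locallyCompact_of_finiteDimensional 𝓘(ℝ, E).tangent.tangent
  have h2 := isCountablyGenerated_nhds_continuousMap (tangentTangentC f)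
  have h1 := isCountablyGenerated_nhds_c1Topology f
  rw [c2Topology, nhds_inf, nhds_induced (f := tangentTangentC)]
  have h3 := Filter.comap.isCountablyGenerated (𝓝 (tangentTangentC f)) tangentTangentC
  exact Filter.Inf.isCountablyGenerated _ _

end Countability

/-! ### From sequences to families indexed by `ε > 0` -/

/-- A sequence index that tends to infinity as `ε → 0` and equals `n` at `ε = 1 / (n + 1)`. -/
noncomputable def invIndex (ε : ℝ) : ℕ := ⌊ε⁻¹⌋₊ - 1

theorem tendsto_invIndex : Tendsto invIndex (𝓝[>] 0) atTop :=
  (tendsto_sub_atTop_nat 1).comp (tendsto_nat_floor_atTop.comp tendsto_inv_nhdsGT_zero)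

theorem invIndex_inv (n : ℕ) : invIndex ((n : ℝ) + 1)⁻¹ = n := by
  rw [invIndex, inv_inv, ← Nat.cast_succ, Nat.floor_natCast]
  rfl

theorem tendsto_inv_natCast_add_one : Tendsto (fun n : ℕ => ((n : ℝ) + 1)⁻¹) atTop (𝓝[>] 0) :=
  tendsto_nhdsWithin_iff.2 ⟨by simpa using tendsto_one_div_add_atTop_nhds_zero_nat (𝕜 := ℝ),
    Eventually.of_forall fun n => by simp only [mem_Ioi]; positivity⟩

/-! ### Openness of the expanding maps -/

theorem mainTheorem5
    {E : Type*} [NormedAddCommGroup E] [NormedSpace ℝ E] [FiniteDimensional ℝ E]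
    {M : Type*} [EMetricSpace M] [CompactSpace M] [ChartedSpace E M]
    [IsManifold 𝓘(ℝ, E) ∞ M]
    [RiemannianBundle (fun x : M => TangentSpace 𝓘(ℝ, E) x)]
    [IsContMDiffRiemannianBundle 𝓘(ℝ, E) ∞ E (fun x : M => TangentSpace 𝓘(ℝ, E) x)]
    [IsRiemannianManifold 𝓘(ℝ, E) M]
    [MeasurableSpace M] [BorelSpace M]
    (τ : TopologicalSpace C^2⟮𝓘(ℝ, E), M; 𝓘(ℝ, E), M⟯)
    (hτ : τ = c1Topology E M ∨ τ = c2Topology E M)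
    (F : Set C^2⟮𝓘(ℝ, E), M; 𝓘(ℝ, E), M⟯)
    (hloc : ∀ f ∈ F, IsLocalDiffeomorph 𝓘(ℝ, E) 𝓘(ℝ, E) 2 f)
    (hstab : ∀ f ∈ F, IsStatisticallyStable E τ F f) :
    IsOpen[τ.induced (Subtype.val : F → C^2⟮𝓘(ℝ, E), M; 𝓘(ℝ, E), M⟯)]
      {f : F | ∀ μ : ProbabilityMeasure M, IsSRB E f.1 μ → IsExpanding E f.1 μ} := by
  -- The cocycles depend on first derivatives only, so it is enough that `τ` refines the `C^1`
  -- topology.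
  have hle : τ ≤ c1Topology E M := by
    rcases hτ with rfl | rfl
    · exact le_rfl
    · exact inf_le_left
  have hcg : ∀ f, (@nhds _ τ f).IsCountablyGenerated := fun f => by
    rcases hτ with rfl | rfl
    · exact isCountablyGenerated_nhds_c1Topology f
    · exact isCountablyGenerated_nhds_c2Topology f
  have : IsContinuousRiemannianBundle E (fun x : M => TangentSpace 𝓘(ℝ, E) x) := by
    obtain ⟨b, hb, hb'⟩ := IsContMDiffRiemannianBundle.exists_contMDiff (IB := 𝓘(ℝ, E)) (n := ∞)
      (F := E) (E := fun x : M => TangentSpace 𝓘(ℝ, E) x)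
    exact ⟨b, hb.continuous, hb'⟩
  obtain ⟨N, e, he, -, hinj⟩ := exists_embedding_euclidean_of_compact (I := 𝓘(ℝ, E)) (M := M)
  have he1 : ContMDiff 𝓘(ℝ, E) 𝓘(ℝ, EuclideanSpace ℝ (Fin N)) 1 e := he.of_le (by simp)
  have hι := isClosedEmbedding_tangentToProd he1 hinj
  have hV : IsClosed {p : M × EuclideanSpace ℝ (Fin N) | p.2 ∈ tangentRange E e p.1} := by
    rw [setOf_mem_tangentRange]
    exact hι.isClosed_range
  have hd : ∀ x, Module.finrank ℝ (tangentRange E e x) = Module.finrank ℝ E :=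
    finrank_tangentRange hι.injective
  let _ := τ
  change IsOpen {f : F | ∀ μ : ProbabilityMeasure M, IsSRB E f.1 μ → IsExpanding E f.1 μ}
  have hT : Continuous fun k : F => tangentC k.1 :=
    (continuous_iff_le_induced.2 hle).comp continuous_subtype_val
  rw [isOpen_iff_mem_nhds]
  intro f hf
  by_contra hnot
  have := hcg f.1
  have : (𝓝 f).IsCountablyGenerated := by
    rw [nhds_subtype_eq_comap]
    infer_instance
  -- Countably generated neighbourhoods allow a sequence of counterexamples converging to `f`.
  obtain ⟨g, hg, hgA⟩ := exists_seq_forall_of_frequently (not_eventually.1 hnot)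
  simp only [not_forall] at hgA
  choose μ hμ hμe using hgA
  obtain ⟨μ₀, hμ₀, hμ₀e⟩ := exists_mapClusterPt_not_expanding hV hd
    (((continuous_sphereMap_diffCocycle hι hT fun k => hloc k.1 k.2).tendsto f).comp hg)
    (((continuous_logNorm_diffCocycle hι hT fun k => hloc k.1 k.2).tendsto f).comp hg)
    (fun n => (hμ n).1)
    (fun n h => hμe n ((isExpanding_iff he1 hinj hι _ (hloc _ (g n).2) (μ n)).2 h))
  obtain ⟨p, ν, hν, hconv⟩ := hstab f.1 f.2
  -- Stability speaks of families in `ε`. The sequence is reindexed by `invIndex`, and sampling at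
  -- `ε = 1 / (n + 1)` recovers it, so its accumulation points persist.
  have hcl : MapClusterPt μ₀ (𝓝[>] 0) fun ε => μ (invIndex ε) := by
    refine MapClusterPt.of_comp tendsto_inv_natCast_add_one ?_
    simpa only [Function.comp_def, invIndex_inv] using hμ₀
  obtain ⟨w, -, hw⟩ := hconv (fun ε => (g (invIndex ε)).1) (fun ε => μ (invIndex ε))
    (fun ε _ => (g (invIndex ε)).2)
    ((continuous_subtype_val.tendsto f).comp (hg.comp tendsto_invIndex))
    (fun ε _ => hμ (invIndex ε)) μ₀ hcl
  refine hμ₀e ?_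
  have hexp : ∀ i, (diffCocycle hι f.1 (hloc f.1 f.2)).Expanding (ν i : Measure M) := fun i =>
    (isExpanding_iff he1 hinj hι _ (hloc _ f.2) (ν i)).1 (hf (ν i) (hν i))
  -- The exceptional set is null for each `ν i`, hence for their combination `μ₀`.
  rw [BundleCocycle.Expanding, ae_iff, hw, Measure.finsetSum_apply]
  refine Finset.sum_eq_zero fun i _ => ?_
  rw [Measure.smul_apply, show (ν i : Measure M) _ = 0 from ae_iff.1 (hexp i), smul_zero]
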